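/- For a real number $q$ with $|q|<1$ put $\zeta_q(2)=\sum_{n=1}^{\infty}\sigma_1(n)q^n$, where $\sigma_1(n)=\sum_{d\mid n}d$. The irrationality exponent $\mu(\alpha)$ of a real irrational number $\alpha$ is the least real number $\mu$ such that for every $\varepsilon>0$ the inequality $|\alpha-a/b|\le b^{-(\mu+\varepsilon)}$ has only finitely many solutions in integers $a$ and $b$ with $b>0$. There is an absolute constant $c=4.07869374\dots$ (that is, $4.07869374\le c<4.07869375$) such that for every integer $p\notin\{0,1,-1\}$ and $q=1/p$, the number $\zeta_q(2)$ is irrational, and its irrationality exponent exists, is finite, and satisfies $\mu(\zeta_q(2))\le c$. -/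

import Mathlib

noncomputable section

/-- The `q`-zeta value `ζ_q(k) = ∑_{n ≥ 0} σ_{k-1}(n) q^n`, for `k = 1, 2, …` and real `q` with
`|q| < 1`; here `σ_j(n) = ∑_{d ∣ n} d^j`, and the term with `n = 0` is zero. -/
def qZeta (q : ℝ) (k : ℕ) : ℝ :=
  ∑' n : ℕ, (ArithmeticFunction.sigma (k - 1) n : ℝ) * q ^ n

/-- `μ` is the irrationality exponent of `α`: the least real exponent such that for every `ε > 0`
the inequality `|α - a / b| ≤ b ^ (-(μ + ε))` has only finitely many solutions in integers
`a` and `b` (with `b` positive). -/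
def IsIrrationalityExponent (α μ : ℝ) : Prop :=
  IsLeast {m : ℝ | ∀ ε : ℝ, 0 < ε →
    {x : ℤ × ℤ | 0 < x.2 ∧ |α - (x.1 : ℝ) / (x.2 : ℝ)| ≤ (x.2 : ℝ) ^ (-(m + ε))}.Finite} μ

end

open Filter Topology

/-- Only finitely many rationals with bounded denominators satisfy an approximation inequality. -/
lemma finite_approx_of_denominator_le {α e : ℝ} {M : ℝ}
    (h : ∀ a b : ℤ, 0 < b → |α - (a : ℝ) / (b : ℝ)| ≤ (b : ℝ) ^ (-e) → (b : ℝ) ≤ M) :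
    {x : ℤ × ℤ | 0 < x.2 ∧ |α - (x.1 : ℝ) / (x.2 : ℝ)| ≤ (x.2 : ℝ) ^ (-e)}.Finite := by
  have hfin : (⋃ b ∈ Set.Icc (1 : ℤ) ⌊M⌋,
      (fun a : ℤ => (a, b)) '' Set.Icc ⌊(b : ℝ) * (α - (b : ℝ) ^ (-e))⌋
        ⌈(b : ℝ) * (α + (b : ℝ) ^ (-e))⌉).Finite :=
    (Set.finite_Icc _ _).biUnion fun b _ => (Set.finite_Icc _ _).image _
  refine hfin.subset ?_
  rintro ⟨a, b⟩ ⟨hb, hab⟩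
  simp only at hb hab
  have hb' : (0 : ℝ) < b := by exact_mod_cast hb
  simp only [Set.mem_iUnion, Set.mem_image, Set.mem_Icc, Prod.mk.injEq]
  refine ⟨b, ⟨hb, Int.le_floor.2 (h a b hb hab)⟩, a, ⟨?_, ?_⟩, rfl, rfl⟩
  · have h1 := (abs_le.1 hab).2
    have h2 : (b : ℝ) * (α - (b : ℝ) ^ (-e)) ≤ a := by
      have : (a : ℝ) = b * (a / b) := by field_simp
      rw [this]
      exact mul_le_mul_of_nonneg_left (by linarith) hb'.le
    exact_mod_cast (Int.floor_le _).trans h2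
  · have h1 := (abs_le.1 hab).1
    have h2 : (a : ℝ) ≤ (b : ℝ) * (α + (b : ℝ) ^ (-e)) := by
      have : (a : ℝ) = b * (a / b) := by field_simp
      rw [this]
      exact mul_le_mul_of_nonneg_left (by linarith) hb'.le
    exact_mod_cast h2.trans (Int.le_ceil _)

/-- Every real number has infinitely many approximations `a / b` of quality `1 / b`. -/
lemma infinite_approx_exponent_one (α : ℝ) :
    {x : ℤ × ℤ | 0 < x.2 ∧ |α - (x.1 : ℝ) / (x.2 : ℝ)| ≤ (x.2 : ℝ) ^ (-(1 : ℝ))}.Infinite := by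
  refine Set.infinite_of_injective_forall_mem
    (f := fun n : ℕ => (round (α * ((n : ℝ) + 1)), (n : ℤ) + 1)) ?_ ?_
  · intro m n hmn
    simpa using congrArg Prod.snd hmn
  · intro n
    have hn : (0 : ℝ) < (n : ℝ) + 1 := by positivity
    refine ⟨by positivity, ?_⟩
    push_cast
    rw [Real.rpow_neg_one]
    have h := abs_sub_round (α * ((n : ℝ) + 1))
    have : α - (round (α * ((n : ℝ) + 1)) : ℝ) / ((n : ℝ) + 1)
        = (α * ((n : ℝ) + 1) - round (α * ((n : ℝ) + 1))) * ((n : ℝ) + 1)⁻¹ := by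
      field_simp
    rw [this, abs_mul, abs_of_pos (inv_pos.2 hn)]
    exact mul_le_of_le_one_left (inv_pos.2 hn).le (h.trans (by norm_num))

/-- The irrationality exponent exists as soon as some exponent is admissible, and is at most
that exponent. -/
lemma exists_irrationalityExponent_le {α m : ℝ}
    (hm : ∀ ε : ℝ, 0 < ε →
      {x : ℤ × ℤ | 0 < x.2 ∧ |α - (x.1 : ℝ) / (x.2 : ℝ)| ≤ (x.2 : ℝ) ^ (-(m + ε))}.Finite) :
    ∃ μ : ℝ, IsIrrationalityExponent α μ ∧ μ ≤ m := by
  set S := {m : ℝ | ∀ ε : ℝ, 0 < ε →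
    {x : ℤ × ℤ | 0 < x.2 ∧ |α - (x.1 : ℝ) / (x.2 : ℝ)| ≤ (x.2 : ℝ) ^ (-(m + ε))}.Finite}
  have hmS : m ∈ S := hm
  have hbdd : BddBelow S := by
    refine ⟨1, fun x hx => ?_⟩
    by_contra! hlt
    have := hx (1 - x) (by linarith)
    rw [add_sub_cancel] at this
    exact infinite_approx_exponent_one α this
  refine ⟨sInf S, ⟨fun ε hε => ?_, fun x hx => csInf_le hbdd hx⟩, csInf_le hbdd hmS⟩
  obtain ⟨x, hx, hxlt⟩ := Real.lt_sInf_add_pos ⟨m, hmS⟩ hε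
  have := hx (sInf S + ε - x) (by linarith)
  rwa [add_sub_cancel] at this

/-- Integer linear forms in `1, α` that are nonzero and tend to zero show that `α` is
irrational. -/
lemma irrational_of_linearForms {α : ℝ} {A B : ℕ → ℤ}
    (h0 : ∀ᶠ h in atTop, (A h : ℝ) * α - B h ≠ 0)
    (hlim : Tendsto (fun h => (A h : ℝ) * α - B h) atTop (𝓝 0)) : Irrational α := by
  rintro ⟨r, rfl⟩
  have hd : (0 : ℝ) < r.den := by exact_mod_cast r.den_pos
  have h1 : ∀ᶠ h in atTop, |(A h : ℝ) * r - B h| < 1 / (r.den : ℝ) :=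
    hlim.abs.eventually (gt_mem_nhds (by rw [abs_zero]; positivity))
  obtain ⟨h, hne, hlt⟩ := (h0.and h1).exists
  have hr : (r : ℝ) = r.num / r.den := by exact_mod_cast (Rat.num_div_den r).symm
  have key : ((A h : ℝ) * r - B h) = ((A h * r.num - B h * r.den : ℤ) : ℝ) / r.den := by
    push_cast
    nth_rw 1 [hr]
    field_simp
  rw [key] at hne hlt
  have hne' : (A h * r.num - B h * r.den : ℤ) ≠ 0 := by
    intro h; rw [h] at hne; simp at hne
  have h2 : (1 : ℝ) ≤ |((A h * r.num - B h * r.den : ℤ) : ℝ)| := by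
    exact_mod_cast Int.one_le_abs hne'
  rw [abs_div, abs_of_pos hd, div_lt_div_iff_of_pos_right hd] at hlt
  linarith

/-- Lower bound for `|α - a / b|` from one small integer linear form. -/
lemma le_abs_sub_div_of_linearForm {α s t : ℝ} {A B a b : ℤ} (hb : 0 < b)
    (hlow : Real.exp (-s) ≤ |(A : ℝ) * α - B|) (hup : |(A : ℝ) * α - B| ≤ 1 / (2 * b))
    (hbs : Real.log (2 * b) ≤ s) (hA : |(A : ℝ)| ≤ Real.exp t) :
    Real.exp (-(s + t)) ≤ |α - (a : ℝ) / b| := by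
  have hb' : (0 : ℝ) < b := by exact_mod_cast hb
  have main : Real.exp (-s) ≤ |(A : ℝ)| * |α - (a : ℝ) / b| := by
    by_cases hz : A * a - B * b = 0
    · have hz' : (A : ℝ) * (a / b) = B := by
        have : (A : ℝ) * a - B * b = 0 := by exact_mod_cast hz
        field_simp
        linarith
      rw [← abs_mul, mul_sub, hz']
      exact hlow
    · have h1 : (1 : ℝ) ≤ |(A : ℝ) * a - B * b| := by exact_mod_cast Int.one_le_abs hz
      have h2 : 1 / (b : ℝ) ≤ |(A : ℝ) * (a / b) - B| := by
        have : (A : ℝ) * (a / b) - B = (A * a - B * b) / b := by field_simp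
        rw [this, abs_div, abs_of_pos hb']
        exact div_le_div_of_nonneg_right h1 hb'.le
      have h3 : |(A : ℝ) * (a / b) - B| ≤
          |(A : ℝ) * α - B| + |(A : ℝ)| * |α - (a : ℝ) / b| := by
        rw [← abs_mul]
        have : (A : ℝ) * (a / b) - B = ((A : ℝ) * α - B) - A * (α - a / b) := by ring
        rw [this]
        exact abs_sub _ _
      have h4 : Real.exp (-s) ≤ 1 / (2 * b) := by
        rw [Real.exp_neg, ← one_div]
        apply one_div_le_one_div_of_le (by positivity)
        rwa [← Real.log_le_iff_le_exp (by positivity)]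
      have h5 : 1 / (b : ℝ) = 1 / (2 * b) + 1 / (2 * b) := by field_simp; norm_num
      linarith
  have h6 : Real.exp (-s) ≤ Real.exp t * |α - (a : ℝ) / b| :=
    main.trans (mul_le_mul_of_nonneg_right hA (abs_nonneg _))
  rw [neg_add, add_comm, Real.exp_add, Real.exp_neg t]
  rw [inv_mul_le_iff₀ (Real.exp_pos t)]
  exact h6

/-- Upper bound for the irrationality exponent from integer linear forms of size
`exp (-τ h²)` with coefficients of size at most `exp (σ h²)`. -/
lemma finite_approx_of_linearForms {α τ σ : ℝ} {A B : ℕ → ℤ} (hτ : 0 < τ) (hσ : 0 ≤ σ)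
    (hlow : ∀ δ > 0, ∀ᶠ h : ℕ in atTop,
      Real.exp (-((τ + δ) * (h : ℝ) ^ 2)) ≤ |(A h : ℝ) * α - B h|)
    (hup : ∀ δ > 0, ∀ᶠ h : ℕ in atTop,
      |(A h : ℝ) * α - B h| ≤ Real.exp (-((τ - δ) * (h : ℝ) ^ 2)))
    (hA : ∀ δ > 0, ∀ᶠ h : ℕ in atTop, |(A h : ℝ)| ≤ Real.exp ((σ + δ) * (h : ℝ) ^ 2))
    (ε : ℝ) (hε : 0 < ε) :
    {x : ℤ × ℤ | 0 < x.2 ∧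
      |α - (x.1 : ℝ) / (x.2 : ℝ)| ≤ (x.2 : ℝ) ^ (-(1 + σ / τ + ε))}.Finite := by
  set K := 1 + σ / τ + ε with hK
  have hKpos : 0 < K := by positivity
  have hKτ : K * τ = τ + σ + ε * τ := by rw [hK]; field_simp
  set δ := ε * τ / (2 * (K + 2)) with hδ
  have hδpos : 0 < δ := by positivity
  have hδK : δ * (K + 2) = ε * τ / 2 := by rw [hδ]; field_simp
  have hεK : ε < K := by rw [hK]; linarith [div_nonneg hσ hτ.le]
  have hδτ : δ < τ := by
    have : δ * (K + 2) < τ * (K + 2) := by rw [hδK]; nlinarith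
    exact lt_of_mul_lt_mul_right this (by linarith)
  obtain ⟨h₀, hh₀⟩ := eventually_atTop.1 ((hlow δ hδpos).and ((hup δ hδpos).and (hA δ hδpos)))
  set θ := τ - δ with hθ
  have hθpos : 0 < θ := by linarith
  set M := (2 * K * θ + K) / (ε * τ / 2) with hM
  have hMpos : 0 < M := by positivity
  refine finite_approx_of_denominator_le (M := Real.exp (θ * (max M h₀) ^ 2)) ?_
  intro a b hb hab
  have hb' : (1 : ℝ) ≤ b := by exact_mod_cast hb
  have hb0 : (0 : ℝ) < b := by linarith
  have hlog2 : 0 < Real.log 2 := Real.log_pos (by norm_num)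
  have hlogb : 0 ≤ Real.log b := Real.log_nonneg hb'
  have hlog : Real.log (2 * b) = Real.log 2 + Real.log b := Real.log_mul (by norm_num) hb0.ne'
  set y := Real.sqrt (Real.log (2 * b) / θ) with hy
  have hysq : θ * y ^ 2 = Real.log (2 * b) := by
    rw [hy, Real.sq_sqrt (div_nonneg (by linarith) hθpos.le)]
    field_simp
  have hy0 : 0 ≤ y := Real.sqrt_nonneg _
  set h := ⌊y⌋₊ + 1 with hh
  have hyh : y ≤ h := by rw [hh]; push_cast; exact (Nat.lt_floor_add_one y).le
  have hhy : (h : ℝ) - 1 ≤ y := by rw [hh]; push_cast; simpa using Nat.floor_le hy0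
  have hh1 : (1 : ℝ) ≤ h := by rw [hh]; push_cast; simp
  have hbh : Real.log (2 * b) ≤ θ * (h : ℝ) ^ 2 := by rw [← hysq]; gcongr
  suffices hs : (h : ℝ) ≤ max M h₀ by
    rw [← Real.log_le_iff_le_exp hb0]
    calc Real.log b ≤ Real.log (2 * b) := by linarith
      _ ≤ θ * (h : ℝ) ^ 2 := hbh
      _ ≤ _ := by gcongr
  by_cases hlt : h < h₀
  · exact le_max_of_le_right (by exact_mod_cast hlt.le)
  apply le_max_of_le_left
  obtain ⟨k1, k2, k3⟩ := hh₀ h (not_lt.1 hlt)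
  have k2' : |(A h : ℝ) * α - B h| ≤ 1 / (2 * b) := by
    refine k2.trans ?_
    rw [Real.exp_neg, ← one_div]
    apply one_div_le_one_div_of_le (by positivity)
    rwa [← Real.log_le_iff_le_exp (by positivity)]
  have k4 := le_abs_sub_div_of_linearForm (a := a) hb k1 k2'
    (hbh.trans (mul_le_mul_of_nonneg_right (by linarith) (sq_nonneg _))) k3
  have k5 := k4.trans hab
  rw [Real.rpow_def_of_pos hb0, Real.exp_le_exp] at k5
  have k6 : K * Real.log b ≤ (τ + σ + 2 * δ) * (h : ℝ) ^ 2 := by nlinarith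
  have k7 : θ * ((h : ℝ) - 1) ^ 2 ≤ Real.log 2 + Real.log b := by
    rw [← hlog, ← hysq]
    have : 0 ≤ (h : ℝ) - 1 := by linarith
    gcongr
  have k8 : K * (θ * ((h : ℝ) - 1) ^ 2) ≤ K * 1 + (τ + σ + 2 * δ) * (h : ℝ) ^ 2 := by
    have : Real.log 2 ≤ 1 := by linarith [Real.log_two_lt_d9]
    have := mul_le_mul_of_nonneg_left k7 hKpos.le
    nlinarith
  have k9 : K * θ - (τ + σ + 2 * δ) = ε * τ / 2 := by rw [hθ]; linarith
  rw [hM, le_div_iff₀ (by positivity)]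
  have hKθ : 0 < K * θ := by positivity
  have k10 : (ε * τ / 2) * (h : ℝ) ^ 2 ≤ (2 * K * θ + K) * h := by
    rw [← k9]
    have hsq : K * θ * ((h : ℝ) - 1) ^ 2 = K * θ * (h : ℝ) ^ 2 - 2 * K * θ * h + K * θ := by ring
    have hKh : K * 1 ≤ K * h := mul_le_mul_of_nonneg_left hh1 hKpos.le
    linarith
  refine le_of_mul_le_mul_right ?_ (by linarith : (0 : ℝ) < h)
  linarith

open ArithmeticFunction in
lemma tsum_moebius_div_sq : ∑' n : ℕ, (moebius n : ℝ) / (n : ℝ) ^ 2 = 6 / Real.pi ^ 2 := by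
  have h1 := LSeries_zeta_mul_Lseries_moebius (s := 2) (by norm_num)
  rw [LSeries_zeta_eq_riemannZeta (by norm_num), riemannZeta_two] at h1
  have h2 : LSeries (fun n => ((moebius n : ℤ) : ℂ)) 2
      = ((∑' n : ℕ, (moebius n : ℝ) / (n : ℝ) ^ 2 : ℝ) : ℂ) := by
    rw [LSeries, Complex.ofReal_tsum]
    refine tsum_congr fun n => ?_
    rcases eq_or_ne n 0 with rfl | hn
    · simp
    · rw [LSeries.term_of_ne_zero hn]
      push_cast
      norm_num
  rw [h2] at h1
  have h3 : Real.pi ^ 2 / 6 * (∑' n : ℕ, (moebius n : ℝ) / (n : ℝ) ^ 2) = 1 := by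
    exact_mod_cast h1
  have := Real.pi_pos
  field_simp at h3 ⊢
  linarith

/-- The arithmetic function `n ↦ n`, with real values. -/
def realId : ArithmeticFunction ℝ := ⟨fun n => (n : ℝ), by simp⟩

open ArithmeticFunction in
lemma moebius_mul_realId {d : ℕ} (hd : 0 < d) :
    ((moebius : ArithmeticFunction ℝ) * realId) d = (Nat.totient d : ℝ) := by
  have h := (sum_eq_iff_sum_mul_moebius_eq (R := ℝ) (f := fun n => (Nat.totient n : ℝ))
    (g := fun n => (n : ℝ))).1 (fun n _ => by exact_mod_cast Nat.sum_totient n) d hd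
  rw [← h, mul_apply]
  rfl

lemma sum_Ioc_realId (N : ℕ) : ∑ m ∈ Finset.Ioc 0 N, realId m = (N : ℝ) * (N + 1) / 2 := by
  induction N with
  | zero => simp
  | succ N ih =>
    rw [← Finset.insert_Ioc_right_eq_Ioc_add_one (Nat.zero_le N), Finset.sum_insert (by simp), ih]
    simp only [realId, ArithmeticFunction.coe_mk]
    push_cast
    ring

open ArithmeticFunction in
lemma sum_totient_eq_tsum (n : ℕ) :
    ∑ d ∈ Finset.Ioc 0 n, (Nat.totient d : ℝ) =
      ∑' f : ℕ, (moebius f : ℝ) * (((n / f : ℕ) : ℝ) * ((n / f : ℕ) + 1) / 2) := by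
  rw [tsum_eq_sum (s := Finset.Ioc 0 n)]
  · rw [← Finset.sum_congr rfl fun d hd => moebius_mul_realId (Finset.mem_Ioc.1 hd).1,
      sum_Ioc_mul_eq_sum_sum]
    refine Finset.sum_congr rfl fun f _ => ?_
    rw [sum_Ioc_realId]
    rfl
  · intro f hf
    have : n / f = 0 := by
      rw [Nat.div_eq_zero_iff]
      simp at hf
      omega
    simp [this]

open ArithmeticFunction in
/-- The summatory function of Euler's totient is asymptotic to `3 n² / π²`. -/
lemma tendsto_sum_totient_div_sq :
    Tendsto (fun n : ℕ => (∑ d ∈ Finset.Ioc 0 n, (Nat.totient d : ℝ)) / (n : ℝ) ^ 2) atTop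
      (𝓝 (3 / Real.pi ^ 2)) := by
  have hlim : ∑' f : ℕ, (moebius f : ℝ) * (1 / (f : ℝ) ^ 2 / 2) = 3 / Real.pi ^ 2 := by
    have : ∀ f : ℕ, (moebius f : ℝ) * (1 / (f : ℝ) ^ 2 / 2)
        = (moebius f : ℝ) / (f : ℝ) ^ 2 * (1 / 2) := fun f => by ring
    simp_rw [this]
    rw [tsum_mul_right, tsum_moebius_div_sq]
    ring
  rw [← hlim]
  have heq : ∀ n : ℕ, (∑ d ∈ Finset.Ioc 0 n, (Nat.totient d : ℝ)) / (n : ℝ) ^ 2 =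
      ∑' f : ℕ, (moebius f : ℝ) *
        ((((n / f : ℕ) : ℝ) / n) * (((n / f : ℕ) : ℝ) / n + 1 / n) / 2) := by
    intro n
    rw [sum_totient_eq_tsum, ← tsum_div_const]
    refine tsum_congr fun f => ?_
    rcases eq_or_ne n 0 with rfl | hn
    · simp
    · have : (n : ℝ) ≠ 0 := by exact_mod_cast hn
      field_simp
  simp_rw [heq]
  have hdiv : ∀ n f : ℕ, ((n / f : ℕ) : ℝ) / n ≤ 1 / f := by
    intro n f
    rcases eq_or_ne n 0 with rfl | hn
    · simp
    have hn' : (0 : ℝ) < n := by positivity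
    rw [div_le_iff₀ hn', one_div_mul_eq_div]
    exact Nat.cast_div_le
  refine tendsto_tsum_of_dominated_convergence (bound := fun f : ℕ => 1 / (f : ℝ) ^ 2)
    (Real.summable_one_div_nat_pow.2 one_lt_two) ?_ ?_
  · intro f
    have h1 : Tendsto (fun n : ℕ => ((n / f : ℕ) : ℝ) / n) atTop (𝓝 (1 / f)) := by
      have := (tendsto_nat_floor_mul_div_atTop (R := ℝ) (a := 1 / f) (by positivity)).comp
        tendsto_natCast_atTop_atTop
      refine this.congr fun n => ?_
      simp only [Function.comp]
      rw [one_div_mul_eq_div, Nat.floor_div_eq_div]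
    have h2 := tendsto_one_div_atTop_nhds_zero_nat (𝕜 := ℝ)
    have h3 := ((h1.mul (h1.add h2)).div_const 2).const_mul (moebius f : ℝ)
    convert h3 using 2
    ring
  · filter_upwards [eventually_ge_atTop 1] with n hn f
    have hn' : (0 : ℝ) < n := by exact_mod_cast hn
    have hmu : |(moebius f : ℝ)| ≤ 1 := by exact_mod_cast abs_moebius_le_one
    have hb : (((n / f : ℕ) : ℝ) / n) * (((n / f : ℕ) : ℝ) / n + 1 / n) / 2 ≤ 1 / (f : ℝ) ^ 2 := by
      by_cases h0 : n / f = 0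
      · simp [h0]
      · have h1 : (1 : ℝ) / n ≤ ((n / f : ℕ) : ℝ) / n := by
          gcongr
          exact_mod_cast Nat.one_le_iff_ne_zero.2 h0
        have h2 := hdiv n f
        have h3 : 0 < 1 / (n : ℝ) := by positivity
        have : (1 : ℝ) / (f : ℝ) ^ 2 = (1 / f) * (1 / f) := by ring
        rw [this]
        nlinarith
    have h0 : 0 ≤ (((n / f : ℕ) : ℝ) / n) * (((n / f : ℕ) : ℝ) / n + 1 / n) / 2 := by positivity
    rw [Real.norm_eq_abs, abs_mul, abs_of_nonneg h0]
    exact (mul_le_of_le_one_left h0 hmu).trans hb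

/-- The integer `∏_{d ≤ n} Φ_d(p)`, a common multiple of `p - 1, …, p ^ n - 1`. -/
noncomputable def cycProd (p : ℤ) (n : ℕ) : ℤ := ∏ d ∈ Finset.Ioc 0 n, (Polynomial.cyclotomic d ℤ).eval p

lemma prod_eval_cyclotomic (p : ℤ) {m : ℕ} (hm : 0 < m) :
    ∏ d ∈ m.divisors, (Polynomial.cyclotomic d ℤ).eval p = p ^ m - 1 := by
  rw [← Polynomial.eval_prod, Polynomial.prod_cyclotomic_eq_X_pow_sub_one hm]
  simp

lemma abs_pow_sub_one_lower {p : ℤ} (hp : 2 ≤ |p|) {m : ℕ} (hm : 0 < m) :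
    |(p : ℝ)| ^ m / 2 ≤ |(p : ℝ) ^ m - 1| := by
  have hp' : (2 : ℝ) ≤ |(p : ℝ)| := by exact_mod_cast hp
  have h1 : (2 : ℝ) ≤ |(p : ℝ)| ^ m := hp'.trans (le_self_pow₀ (by linarith) hm.ne')
  have h2 := abs_sub_abs_le_abs_sub ((p : ℝ) ^ m) 1
  rw [abs_pow, abs_one] at h2
  linarith

lemma pow_sub_one_ne_zero {p : ℤ} (hp : 2 ≤ |p|) {m : ℕ} (hm : 0 < m) : p ^ m - 1 ≠ 0 := by
  have h := abs_pow_sub_one_lower hp hm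
  intro h0
  have h0' : (p : ℝ) ^ m - 1 = 0 := by exact_mod_cast h0
  have hp' : (2 : ℝ) ≤ |(p : ℝ)| := by exact_mod_cast hp
  have : 0 < |(p : ℝ)| ^ m := by positivity
  rw [h0', abs_zero] at h
  linarith

lemma eval_cyclotomic_ne_zero {p : ℤ} (hp : 2 ≤ |p|) {d : ℕ} (hd : 0 < d) :
    (Polynomial.cyclotomic d ℤ).eval p ≠ 0 := by
  have h := prod_eval_cyclotomic p hd
  have h1 := pow_sub_one_ne_zero hp hd
  rw [← h, Finset.prod_ne_zero_iff] at h1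
  exact h1 d (Nat.mem_divisors_self d hd.ne')

lemma abs_log_pow_sub_one_sub {p : ℤ} (hp : 2 ≤ |p|) {m : ℕ} (hm : 0 < m) :
    |Real.log |(p : ℝ) ^ m - 1| - m * Real.log (|(p : ℝ)|)| ≤ 2 * (1 / 2) ^ m := by
  have hp' : (2 : ℝ) ≤ |(p : ℝ)| := by exact_mod_cast hp
  set Q := |(p : ℝ)| ^ m with hQ
  have hQ2 : (2 : ℝ) ^ m ≤ Q := by rw [hQ]; gcongr
  have h2m : (2 : ℝ) ≤ 2 ^ m := le_self_pow₀ (by norm_num) hm.ne'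
  have hQpos : 0 < Q := by linarith
  have habs : |(p : ℝ) ^ m| = Q := abs_pow _ _
  have hinv : (1 / 2 : ℝ) ^ m = 1 / 2 ^ m := by rw [div_pow, one_pow]
  have hQi : 1 / Q ≤ 1 / 2 ^ m := one_div_le_one_div_of_le (by positivity) hQ2
  have hQ1 : 1 / Q ≤ 1 / 2 := one_div_le_one_div_of_le (by positivity) (by linarith)
  have hlow : Q - 1 ≤ |(p : ℝ) ^ m - 1| := by
    have := abs_sub_abs_le_abs_sub ((p : ℝ) ^ m) 1
    rwa [habs, abs_one] at this
  have hupp : |(p : ℝ) ^ m - 1| ≤ Q + 1 := by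
    have := abs_sub ((p : ℝ) ^ m) 1
    rwa [habs, abs_one] at this
  have hpos : 0 < |(p : ℝ) ^ m - 1| := by linarith
  have hlog : Real.log |(p : ℝ) ^ m - 1| - m * Real.log |(p : ℝ)|
      = Real.log (|(p : ℝ) ^ m - 1| / Q) := by
    rw [Real.log_div hpos.ne' hQpos.ne', hQ, Real.log_pow]
  have hxpos : 0 < |(p : ℝ) ^ m - 1| / Q := by positivity
  have hxl : 1 - 1 / Q ≤ |(p : ℝ) ^ m - 1| / Q := by
    rw [le_div_iff₀ hQpos]; field_simp; linarith
  have hxu : |(p : ℝ) ^ m - 1| / Q ≤ 1 + 1 / Q := by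
    rw [div_le_iff₀ hQpos]; field_simp; linarith
  rw [hlog, hinv, abs_le]
  constructor
  · have h1 := Real.one_sub_inv_le_log_of_pos hxpos
    have h2 : (|(p : ℝ) ^ m - 1| / Q)⁻¹ ≤ 1 + 2 * (1 / Q) := by
      rw [inv_le_iff_one_le_mul₀ hxpos]
      have : 0 < 1 / Q := by positivity
      nlinarith
    linarith
  · have h1 := Real.log_le_sub_one_of_pos hxpos
    have : 0 < 1 / Q := by positivity
    linarith

open ArithmeticFunction in
lemma abs_log_eval_cyclotomic_sub {p : ℤ} (hp : 2 ≤ |p|) {d : ℕ} (hd : 0 < d) :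
    |Real.log |(((Polynomial.cyclotomic d ℤ).eval p : ℤ) : ℝ)|
      - Nat.totient d * Real.log (|(p : ℝ)|)| ≤ 4 := by
  set L := Real.log |(p : ℝ)|
  have h := (sum_eq_iff_sum_mul_moebius_eq (R := ℝ)
    (f := fun d => Real.log |(((Polynomial.cyclotomic d ℤ).eval p : ℤ) : ℝ)| - Nat.totient d * L)
    (g := fun m => Real.log |(p : ℝ) ^ m - 1| - m * L)).1 (by
      intro m hm
      rw [Finset.sum_sub_distrib, ← Finset.sum_mul]
      congr 1
      · rw [← Real.log_prod, ← Finset.abs_prod]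
        · congr 2
          exact_mod_cast prod_eval_cyclotomic p hm
        · intro d hd'
          rw [abs_ne_zero]
          exact_mod_cast eval_cyclotomic_ne_zero hp (Nat.pos_of_mem_divisors hd')
      · congr 1
        exact_mod_cast Nat.sum_totient m) d hd
  rw [← h, Nat.sum_divisorsAntidiagonal' (f := fun a b => (moebius a : ℝ) *
    (Real.log |(p : ℝ) ^ b - 1| - b * L))]
  calc _ ≤ ∑ b ∈ d.divisors, |(moebius (d / b) : ℝ) *
      (Real.log |(p : ℝ) ^ b - 1| - b * L)| := Finset.abs_sum_le_sum_abs _ _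
    _ ≤ ∑ b ∈ d.divisors, 2 * (1 / 2 : ℝ) ^ b := by
      refine Finset.sum_le_sum fun b hb => ?_
      rw [abs_mul]
      have hmu : |(moebius (d / b) : ℝ)| ≤ 1 := by exact_mod_cast abs_moebius_le_one
      exact (mul_le_of_le_one_left (abs_nonneg _) hmu).trans
        (abs_log_pow_sub_one_sub hp (Nat.pos_of_mem_divisors hb))
    _ ≤ ∑' b : ℕ, 2 * (1 / 2 : ℝ) ^ b :=
      (summable_geometric_two.mul_left 2).sum_le_tsum _ fun _ _ => by positivity
    _ = 4 := by rw [tsum_mul_left, tsum_geometric_two]; norm_num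

lemma cycProd_ne_zero {p : ℤ} (hp : 2 ≤ |p|) (n : ℕ) : cycProd p n ≠ 0 :=
  Finset.prod_ne_zero_iff.2 fun _ hd => eval_cyclotomic_ne_zero hp (Finset.mem_Ioc.1 hd).1

/-- `log |∏_{d ≤ n} Φ_d(p)|` is asymptotic to `(3 / π²) log |p| n²`. -/
lemma tendsto_log_cycProd_div_sq {p : ℤ} (hp : 2 ≤ |p|) :
    Tendsto (fun n : ℕ => Real.log |(cycProd p n : ℝ)| / (n : ℝ) ^ 2) atTop
      (𝓝 (3 / Real.pi ^ 2 * Real.log |(p : ℝ)|)) := by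
  set L := Real.log |(p : ℝ)|
  have hlog : ∀ n, Real.log |(cycProd p n : ℝ)|
      = ∑ d ∈ Finset.Ioc 0 n, Real.log |(((Polynomial.cyclotomic d ℤ).eval p : ℤ) : ℝ)| := by
    intro n
    rw [cycProd, Int.cast_prod, Finset.abs_prod, Real.log_prod]
    intro d hd
    rw [abs_ne_zero]
    exact_mod_cast eval_cyclotomic_ne_zero hp (Finset.mem_Ioc.1 hd).1
  have hdiff : ∀ n : ℕ, |Real.log |(cycProd p n : ℝ)|
      - (∑ d ∈ Finset.Ioc 0 n, (Nat.totient d : ℝ)) * L| ≤ 4 * n := by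
    intro n
    rw [hlog, Finset.sum_mul, ← Finset.sum_sub_distrib]
    refine (Finset.abs_sum_le_sum_abs _ _).trans ?_
    refine (Finset.sum_le_sum fun d hd =>
      abs_log_eval_cyclotomic_sub hp (Finset.mem_Ioc.1 hd).1).trans ?_
    simp [mul_comm]
  have h0 : Tendsto (fun n : ℕ => (Real.log |(cycProd p n : ℝ)|
      - (∑ d ∈ Finset.Ioc 0 n, (Nat.totient d : ℝ)) * L) / (n : ℝ) ^ 2) atTop (𝓝 0) := by
    have h4 : Tendsto (fun n : ℕ => 4 * (1 / (n : ℝ))) atTop (𝓝 0) := by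
      simpa using (tendsto_one_div_atTop_nhds_zero_nat (𝕜 := ℝ)).const_mul 4
    refine squeeze_zero_norm (fun n => ?_) h4
    rcases eq_or_ne n 0 with rfl | hn
    · simp
    have hn' : (0 : ℝ) < n := by positivity
    rw [Real.norm_eq_abs, abs_div, abs_of_pos (by positivity : (0 : ℝ) < (n : ℝ) ^ 2),
      div_le_iff₀ (by positivity)]
    refine (hdiff n).trans_eq ?_
    field_simp
  have h1 := h0.add (tendsto_sum_totient_div_sq.mul_const L)
  rw [zero_add] at h1
  refine h1.congr fun n => ?_
  ring

open Polynomial in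
lemma eval_derivative_prod_X_sub_C {K ι : Type*} [Field K] [DecidableEq ι] (s : Finset ι)
    (y : ι → K) (t : K) (ht : ∀ i ∈ s, t - y i ≠ 0) :
    (derivative (∏ i ∈ s, (X - C (y i)))).eval t
      = (∏ i ∈ s, (t - y i)) * ∑ i ∈ s, 1 / (t - y i) := by
  rw [derivative_prod_finset, eval_finsetSum, Finset.mul_sum]
  refine Finset.sum_congr rfl fun i hi => ?_
  rw [← Finset.mul_prod_erase s _ hi]
  have := ht i hi
  simp only [derivative_sub, derivative_X, derivative_C, sub_zero, mul_one, eval_prod, eval_sub,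
    eval_X, eval_C]
  field_simp

open Polynomial in
lemma X_sub_C_sq_dvd_of_eval_eq_zero {K : Type*} [Field K] {E : K[X]} {a : K}
    (h0 : E.eval a = 0) (h1 : (derivative E).eval a = 0) : (X - C a) ^ 2 ∣ E := by
  obtain ⟨F, rfl⟩ := dvd_iff_isRoot.2 h0
  have : F.eval a = 0 := by simpa [derivative_mul] using h1
  obtain ⟨G, rfl⟩ := dvd_iff_isRoot.2 this
  exact ⟨G, by ring⟩

open Polynomial in
/-- Hermite interpolation at double nodes. -/
lemma eq_sum_of_hermite_data {K ι : Type*} [Field K] [DecidableEq ι] (s : Finset ι) (x : ι → K)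
    (hx : ∀ i ∈ s, ∀ j ∈ s, i ≠ j → x i ≠ x j) (W : K[X]) (hW : W.degree < ((2 * s.card : ℕ) : WithBot ℕ))
    (α β : ι → K)
    (hα : ∀ k ∈ s, α k * (∏ j ∈ s.erase k, (x k - x j)) ^ 2 = W.eval (x k))
    (hβ : ∀ k ∈ s, (β k + 2 * α k * ∑ j ∈ s.erase k, 1 / (x k - x j))
      * (∏ j ∈ s.erase k, (x k - x j)) ^ 2 = (derivative W).eval (x k)) :
    W = ∑ k ∈ s, (C (α k) + C (β k) * (X - C (x k))) * (∏ j ∈ s.erase k, (X - C (x j))) ^ 2 := by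
  set V : ι → K[X] := fun k =>
    (C (α k) + C (β k) * (X - C (x k))) * (∏ j ∈ s.erase k, (X - C (x j))) ^ 2 with hV
  rw [← sub_eq_zero]
  set E := W - ∑ k ∈ s, V k with hE
  have hdvdV : ∀ k ∈ s, ∀ l ∈ s, l ≠ k → (X - C (x k)) ^ 2 ∣ V l := by
    intro k hk l hl hlk
    refine Dvd.dvd.mul_left (pow_dvd_pow_of_dvd ?_ 2) _
    exact Finset.dvd_prod_of_mem _ (Finset.mem_erase.2 ⟨hlk.symm, hk⟩)
  have hdvd : ∀ k ∈ s, (X - C (x k)) ^ 2 ∣ E := by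
    intro k hk
    rw [hE, ← Finset.add_sum_erase s _ hk, ← sub_sub]
    refine dvd_sub ?_ (Finset.dvd_sum fun l hl =>
      hdvdV k hk l (Finset.mem_of_mem_erase hl) (Finset.ne_of_mem_erase hl))
    apply X_sub_C_sq_dvd_of_eval_eq_zero
    · rw [eval_sub, ← hα k hk]
      simp [hV, eval_prod]
    · rw [derivative_sub, eval_sub, ← hβ k hk, hV]
      have hne : ∀ j ∈ s.erase k, x k - x j ≠ 0 := fun j hj => sub_ne_zero.2
        (hx k hk j (Finset.mem_of_mem_erase hj) (Finset.ne_of_mem_erase hj).symm)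
      have := eval_derivative_prod_X_sub_C (s.erase k) x (x k) hne
      simp only [derivative_mul, derivative_pow, derivative_add, derivative_sub, derivative_C,
        derivative_X, eval_add, eval_mul, eval_sub, eval_X, eval_C, eval_pow, eval_prod, this,
        eval_one, eval_zero]
      simp
      ring
  have hprod : ∏ k ∈ s, (X - C (x k)) ^ 2 ∣ E := by
    refine Finset.prod_dvd_of_coprime ?_ hdvd
    intro i hi j hj hij
    exact (isCoprime_X_sub_C_of_isUnit_sub
      (sub_ne_zero.2 (hx i hi j hj hij)).isUnit).pow
  have hdegprod : ∀ t : Finset ι, (∏ k ∈ t, (X - C (x k))).degree = (t.card : WithBot ℕ) := fun t => by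
    rw [degree_prod]; simp
  have hdeg : (∏ k ∈ s, (X - C (x k)) ^ 2).degree = ((2 * s.card : ℕ) : WithBot ℕ) := by
    rw [Finset.prod_pow, degree_pow, hdegprod]
    push_cast
    simp [two_mul]
  refine eq_zero_of_dvd_of_degree_lt hprod ?_
  rw [hdeg]
  refine (degree_sub_le _ _).trans_lt (max_lt hW ?_)
  refine (degree_sum_le _ _).trans_lt ?_
  rw [Finset.sup_lt_iff (by exact_mod_cast WithBot.bot_lt_coe _)]
  intro k hk
  have h1 : (C (α k) + C (β k) * (X - C (x k))).degree ≤ 1 := by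
    refine (degree_add_le _ _).trans (max_le (degree_C_le.trans (by norm_num)) ?_)
    refine (degree_mul_le _ _).trans ?_
    rw [degree_X_sub_C]
    calc _ ≤ (0 : WithBot ℕ) + 1 := by gcongr; exact degree_C_le
      _ = 1 := by simp
  have h2 : ((∏ j ∈ s.erase k, (X - C (x j))) ^ 2).degree = ((2 * (s.card - 1) : ℕ) : WithBot ℕ) := by
    rw [degree_pow, hdegprod, Finset.card_erase_of_mem hk]
    simp [two_mul]
  have hpos := Finset.card_pos.2 ⟨k, hk⟩
  calc (V k).degree ≤ 1 + ((2 * (s.card - 1) : ℕ) : WithBot ℕ) := by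
        refine (degree_mul_le _ _).trans ?_
        rw [h2]
        gcongr
    _ = ((1 + 2 * (s.card - 1) : ℕ) : WithBot ℕ) := by push_cast; rfl
    _ < _ := by
        rw [Nat.cast_lt]
        omega

open Polynomial in
/-- Partial fractions with double poles. -/
lemma eval_div_prod_sq_eq_sum {K ι : Type*} [Field K] [DecidableEq ι] (s : Finset ι) (x : ι → K)
    (hx : ∀ i ∈ s, ∀ j ∈ s, i ≠ j → x i ≠ x j) (W : K[X]) (hW : W.degree < ((2 * s.card : ℕ) : WithBot ℕ))
    (α β : ι → K)
    (hα : ∀ k ∈ s, α k * (∏ j ∈ s.erase k, (x k - x j)) ^ 2 = W.eval (x k))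
    (hβ : ∀ k ∈ s, (β k + 2 * α k * ∑ j ∈ s.erase k, 1 / (x k - x j))
      * (∏ j ∈ s.erase k, (x k - x j)) ^ 2 = (derivative W).eval (x k))
    (t : K) (ht : ∀ k ∈ s, t - x k ≠ 0) :
    W.eval t / (∏ k ∈ s, (t - x k)) ^ 2 = ∑ k ∈ s, (α k / (t - x k) ^ 2 + β k / (t - x k)) := by
  have h := congrArg (eval t) (eq_sum_of_hermite_data s x hx W hW α β hα hβ)
  rw [h, eval_finsetSum, Finset.sum_div]
  refine Finset.sum_congr rfl fun k hk => ?_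
  rw [← Finset.mul_prod_erase s _ hk]
  have h1 := ht k hk
  have h2 : ∏ j ∈ s.erase k, (t - x j) ≠ 0 :=
    Finset.prod_ne_zero_iff.2 fun j hj => ht j (Finset.mem_of_mem_erase hj)
  simp only [eval_mul, eval_add, eval_C, eval_sub, eval_X, eval_pow, eval_prod]
  field_simp

/-- The `q`-factorial `∏_{i=1}^m (p^i - 1)` in base `p`. -/
def powFactorial {R : Type*} [CommRing R] (p : R) (m : ℕ) : R := ∏ i ∈ Finset.Ioc 0 m, (p ^ i - 1)

lemma cast_powFactorial (p : ℤ) (m : ℕ) : ((powFactorial p m : ℤ) : ℝ) = powFactorial (p : ℝ) m := by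
  simp [powFactorial]

lemma powFactorial_ne_zero {p : ℤ} (hp : 2 ≤ |p|) (m : ℕ) : powFactorial p m ≠ 0 :=
  Finset.prod_ne_zero_iff.2 fun _ hi => pow_sub_one_ne_zero hp (Finset.mem_Ioc.1 hi).1

lemma cast_powFactorial_ne_zero {p : ℤ} (hp : 2 ≤ |p|) (m : ℕ) :
    powFactorial (p : ℝ) m ≠ 0 := by
  rw [← cast_powFactorial]
  exact_mod_cast powFactorial_ne_zero hp m

lemma powFactorial_add {R : Type*} [CommRing R] (p : R) (k n : ℕ) :
    powFactorial p (n + k) = powFactorial p k * ∏ i ∈ Finset.Ioc 0 n, (p ^ (k + i) - 1) := by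
  induction n with
  | zero => simp
  | succ n ih =>
    rw [show n + 1 + k = n + k + 1 by ring, powFactorial,
      ← Finset.insert_Ioc_right_eq_Ioc_add_one (Nat.zero_le _), Finset.prod_insert (by simp),
      ← Finset.insert_Ioc_right_eq_Ioc_add_one (Nat.zero_le n), Finset.prod_insert (by simp)]
    rw [powFactorial] at ih
    rw [ih, show n + k + 1 = k + (n + 1) by ring]
    ring

@[to_additive]
lemma prod_range_erase_eq {M : Type*} [CommMonoid M] (f : ℕ → M) (k m : ℕ) :
    ∏ j ∈ (Finset.range (k + m + 1)).erase k, f j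
      = (∏ i ∈ Finset.Ioc 0 k, f (k - i)) * ∏ i ∈ Finset.Ioc 0 m, f (k + i) := by
  have hsplit : (Finset.range (k + m + 1)).erase k
      = (Finset.Ioc 0 k).image (fun i => k - i) ∪ (Finset.Ioc 0 m).image (fun i => k + i) := by
    ext j
    simp only [Finset.mem_erase, Finset.mem_range, Finset.mem_union, Finset.mem_image,
      Finset.mem_Ioc]
    constructor
    · rintro ⟨h1, h2⟩
      rcases lt_or_gt_of_ne h1 with h | h
      · exact Or.inl ⟨k - j, by omega, by omega⟩
      · exact Or.inr ⟨j - k, by omega, by omega⟩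
    · rintro (⟨i, h1, h2⟩ | ⟨i, h1, h2⟩) <;> omega
  rw [hsplit, Finset.prod_union, Finset.prod_image, Finset.prod_image]
  · intro a _ b _ hab
    simpa using hab
  · intro a ha b hb hab
    simp only [Finset.coe_Ioc, Set.mem_Ioc] at ha hb
    simp only at hab
    omega
  · rw [Finset.disjoint_left]
    intro j hj1 hj2
    simp only [Finset.mem_image, Finset.mem_Ioc] at hj1 hj2
    omega

lemma prod_pow_add_sq {R : Type*} [CommRing R] (p : R) (k m : ℕ) :
    (∏ i ∈ Finset.Ioc 0 m, p ^ (k + i)) ^ 2 = p ^ (2 * k * m + m * (m + 1)) := by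
  induction m with
  | zero => simp
  | succ m ih =>
    rw [← Finset.insert_Ioc_right_eq_Ioc_add_one (Nat.zero_le m), Finset.prod_insert (by simp),
      mul_pow, ih]
    ring

/-- The summand `p^{h²} ∏_{i≤n}(p^i-1) S² ∏_{i=1}^n (S-p^i) / ∏_{k=0}^n (p^k S-1)²`. -/
noncomputable def summand (p : ℝ) (n h : ℕ) (S : ℝ) : ℝ :=
  p ^ (h ^ 2) * powFactorial p n * S ^ 2 * (∏ i ∈ Finset.Ioc 0 n, (S - p ^ i))
    / (∏ k ∈ Finset.range (n + 1), (p ^ k * S - 1)) ^ 2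

/-- The leading coefficient of `summand` at its double pole `p^{-k}`. -/
noncomputable def leadCoeff (p : ℝ) (n h k : ℕ) : ℝ :=
  (-1) ^ n * p ^ (((k : ℤ) - h).natAbs ^ 2) * (powFactorial p (n + k) * powFactorial p n)
    / (powFactorial p k ^ 3 * powFactorial p (n - k) ^ 2)

/-- The logarithmic derivative of the regularised summand at the double pole `p^{-k}`. -/
noncomputable def regLogDeriv (p : ℝ) (n k : ℕ) : ℝ :=
  1 - (∑ i ∈ Finset.Ioc 0 n, 1 / (p ^ (k + i) - 1)) + 2 * (∑ i ∈ Finset.Ioc 0 k, 1 / (p ^ i - 1))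
    - 2 * ((n - k : ℕ) + ∑ i ∈ Finset.Ioc 0 (n - k), 1 / (p ^ i - 1))

lemma cast_pow_sub_one_ne_zero {p : ℤ} (hp : 2 ≤ |p|) {m : ℕ} (hm : 0 < m) :
    (p : ℝ) ^ m - 1 ≠ 0 := by exact_mod_cast pow_sub_one_ne_zero hp hm

lemma natAbs_sub_sq_add {n h k : ℕ} (hn : n + 1 = 2 * h) (hk : k ≤ n) :
    ((k : ℤ) - h).natAbs ^ 2 + k * (n - k + 1) = h ^ 2 := by
  obtain ⟨m, rfl⟩ := Nat.exists_eq_add_of_le hk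
  rw [Nat.add_sub_cancel_left]
  zify
  rw [sq_abs]
  have : (k : ℤ) + m + 1 = 2 * h := by exact_mod_cast hn
  have hm : (m : ℤ) = 2 * h - k - 1 := by linarith
  rw [hm]
  ring

section PartialFractions

variable {p : ℤ} {n h k : ℕ}

lemma node_sub_node_lower (hp : 2 ≤ |p|) {i : ℕ} (hi : i ≤ k) :
    ((p : ℝ) ^ k)⁻¹ - ((p : ℝ) ^ (k - i))⁻¹ = -((p : ℝ) ^ i - 1) / (p : ℝ) ^ k := by
  have hp0 : (p : ℝ) ≠ 0 := by
    have : p ≠ 0 := by rintro rfl; simp at hp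
    exact_mod_cast this
  obtain ⟨j, rfl⟩ := Nat.exists_eq_add_of_le hi
  rw [Nat.add_sub_cancel_left, pow_add]
  field_simp
  ring

lemma node_sub_node_upper (hp : 2 ≤ |p|) (i : ℕ) :
    ((p : ℝ) ^ k)⁻¹ - ((p : ℝ) ^ (k + i))⁻¹ = ((p : ℝ) ^ i - 1) / (p : ℝ) ^ (k + i) := by
  have hp0 : (p : ℝ) ≠ 0 := by
    have : p ≠ 0 := by rintro rfl; simp at hp
    exact_mod_cast this
  rw [pow_add]
  field_simp

lemma node_sub_zero (hp : 2 ≤ |p|) (i : ℕ) :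
    ((p : ℝ) ^ k)⁻¹ - (p : ℝ) ^ i = -((p : ℝ) ^ (k + i) - 1) / (p : ℝ) ^ k := by
  have hp0 : (p : ℝ) ≠ 0 := by
    have : p ≠ 0 := by rintro rfl; simp at hp
    exact_mod_cast this
  rw [pow_add]
  field_simp
  ring

lemma sq_prod_node_sub (hp : 2 ≤ |p|) (k m : ℕ) :
    (∏ j ∈ (Finset.range (k + m + 1)).erase k, (((p : ℝ) ^ k)⁻¹ - ((p : ℝ) ^ j)⁻¹)) ^ 2
      = (powFactorial (p : ℝ) k * powFactorial (p : ℝ) m) ^ 2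
        / (p : ℝ) ^ (2 * k ^ 2 + (2 * k * m + m * (m + 1))) := by
  rw [prod_range_erase_eq (fun j => ((p : ℝ) ^ k)⁻¹ - ((p : ℝ) ^ j)⁻¹),
    Finset.prod_congr rfl fun i hi => node_sub_node_lower hp (Finset.mem_Ioc.1 hi).2,
    Finset.prod_congr rfl fun i _ => node_sub_node_upper hp i,
    Finset.prod_div_distrib, Finset.prod_div_distrib, mul_pow, div_pow, div_pow, prod_pow_add_sq,
    Finset.prod_neg, mul_pow, ← pow_mul, mul_comm _ 2, pow_mul, neg_one_sq, one_pow, one_mul]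
  simp only [Finset.prod_const, Nat.card_Ioc, Nat.sub_zero]
  rw [div_mul_div_comm, ← mul_pow, ← pow_mul, ← pow_mul, ← pow_add,
    show k * (k * 2) = 2 * k ^ 2 by ring]
  rfl

lemma prod_node_sub_zero (hp : 2 ≤ |p|) (n k : ℕ) :
    ∏ i ∈ Finset.Ioc 0 n, (((p : ℝ) ^ k)⁻¹ - (p : ℝ) ^ i)
      = (-1) ^ n * powFactorial (p : ℝ) (n + k) / (powFactorial (p : ℝ) k * (p : ℝ) ^ (k * n)) := by
  have hk0 := cast_powFactorial_ne_zero hp k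
  rw [Finset.prod_congr rfl fun i _ => node_sub_zero hp i, Finset.prod_div_distrib,
    Finset.prod_neg, powFactorial_add]
  simp only [Finset.prod_const, Nat.card_Ioc, Nat.sub_zero]
  rw [← pow_mul]
  field_simp

/-- The numerator of `summand`, normalised for monic denominators. -/
noncomputable def numPoly (p : ℝ) (n h : ℕ) : Polynomial ℝ :=
  Polynomial.C (p ^ (h ^ 2) * powFactorial p n / p ^ (n * (n + 1))) * Polynomial.X ^ 2
    * ∏ i ∈ Finset.Ioc 0 n, (Polynomial.X - Polynomial.C (p ^ i))

lemma degree_numPoly_lt (p : ℝ) {n : ℕ} (h : ℕ) (hn : 0 < n) :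
    (numPoly p n h).degree < ((2 * (Finset.range (n + 1)).card : ℕ) : WithBot ℕ) := by
  rw [numPoly, mul_assoc]
  have h1 : (Polynomial.X ^ 2 * ∏ i ∈ Finset.Ioc 0 n,
      (Polynomial.X - Polynomial.C (p ^ i))).degree = ((2 + n : ℕ) : WithBot ℕ) := by
    rw [Polynomial.degree_mul, Polynomial.degree_X_pow, Polynomial.degree_prod,
      Finset.sum_congr rfl fun i _ => Polynomial.degree_X_sub_C (p ^ i)]
    simp
  calc _ ≤ (0 : WithBot ℕ) + ((2 + n : ℕ) : WithBot ℕ) := by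
        refine (Polynomial.degree_mul_le _ _).trans ?_
        rw [h1]
        gcongr
        exact Polynomial.degree_C_le
    _ = ((2 + n : ℕ) : WithBot ℕ) := zero_add _
    _ < _ := by
        rw [Finset.card_range, Nat.cast_lt]
        omega

lemma eval_numPoly_node (hp : 2 ≤ |p|) (hn : n + 1 = 2 * h) (hk : k ≤ n) :
    leadCoeff p n h k / (p : ℝ) ^ (2 * k)
      * (∏ j ∈ (Finset.range (n + 1)).erase k, (((p : ℝ) ^ k)⁻¹ - ((p : ℝ) ^ j)⁻¹)) ^ 2
      = (numPoly p n h).eval ((p : ℝ) ^ k)⁻¹ := by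
  have hp0 : (p : ℝ) ≠ 0 := by
    have : p ≠ 0 := by rintro rfl; simp at hp
    exact_mod_cast this
  have he := natAbs_sub_sq_add hn hk
  obtain ⟨m, rfl⟩ := Nat.exists_eq_add_of_le hk
  rw [numPoly, leadCoeff, sq_prod_node_sub hp]
  simp only [Polynomial.eval_mul, Polynomial.eval_C, Polynomial.eval_pow, Polynomial.eval_X,
    Polynomial.eval_prod, Polynomial.eval_sub]
  rw [prod_node_sub_zero hp]
  rw [Nat.add_sub_cancel_left] at he ⊢
  rw [← he]
  set e := ((k : ℤ) - h).natAbs ^ 2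
  have h1 := cast_powFactorial_ne_zero hp k
  have h2 := cast_powFactorial_ne_zero hp m
  have e1 : (p : ℝ) ^ (2 * k ^ 2 + (2 * k * m + m * (m + 1))) * (p : ℝ) ^ (k * (m + 1))
      = (p : ℝ) ^ ((k + m) * (k + m + 1)) * (p : ℝ) ^ (k * (k + m)) := by
    rw [← pow_add, ← pow_add]
    congr 1
    ring
  rw [pow_add _ e, inv_pow, ← pow_mul, mul_comm k 2]
  rw [div_mul_div_comm]
  field_simp
  linear_combination (-1) ^ (k + m) * e1

lemma eval_derivative_numPoly_node (hp : 2 ≤ |p|) (n h k : ℕ) :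
    (Polynomial.derivative (numPoly p n h)).eval ((p : ℝ) ^ k)⁻¹
      = (numPoly p n h).eval ((p : ℝ) ^ k)⁻¹
        * ((p : ℝ) ^ k * (2 - ∑ i ∈ Finset.Ioc 0 n, 1 / ((p : ℝ) ^ (k + i) - 1))) := by
  have hp0 : (p : ℝ) ≠ 0 := by
    have : p ≠ 0 := by rintro rfl; simp at hp
    exact_mod_cast this
  have hne : ∀ i ∈ Finset.Ioc 0 n, (p : ℝ) ^ (k + i) - 1 ≠ 0 := fun i hi =>
    cast_pow_sub_one_ne_zero hp (by have := (Finset.mem_Ioc.1 hi).1; omega)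
  have hd := eval_derivative_prod_X_sub_C (Finset.Ioc 0 n) (fun i => (p : ℝ) ^ i)
    ((p : ℝ) ^ k)⁻¹ (fun i hi => by
      rw [node_sub_zero hp]
      exact div_ne_zero (neg_ne_zero.2 (hne i hi)) (pow_ne_zero _ hp0))
  have hs : ∑ i ∈ Finset.Ioc 0 n, 1 / (((p : ℝ) ^ k)⁻¹ - (p : ℝ) ^ i)
      = -((p : ℝ) ^ k * ∑ i ∈ Finset.Ioc 0 n, 1 / ((p : ℝ) ^ (k + i) - 1)) := by
    rw [Finset.mul_sum, ← Finset.sum_neg_distrib]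
    refine Finset.sum_congr rfl fun i hi => ?_
    rw [node_sub_zero hp]
    have := hne i hi
    field_simp
  rw [hs] at hd
  rw [numPoly]
  simp only [Polynomial.derivative_mul, Polynomial.derivative_C, Polynomial.eval_add,
    Polynomial.eval_mul, Polynomial.derivative_X_pow, Polynomial.eval_C, Polynomial.eval_pow,
    Polynomial.eval_X, hd, Polynomial.eval_zero, Polynomial.eval_prod, Polynomial.eval_sub]
  norm_num
  field_simp
  ring

lemma sum_node_sub (hp : 2 ≤ |p|) (k m : ℕ) :
    ∑ j ∈ (Finset.range (k + m + 1)).erase k, 1 / (((p : ℝ) ^ k)⁻¹ - ((p : ℝ) ^ j)⁻¹)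
      = (p : ℝ) ^ k * (m + ∑ i ∈ Finset.Ioc 0 m, 1 / ((p : ℝ) ^ i - 1)
        - ∑ i ∈ Finset.Ioc 0 k, 1 / ((p : ℝ) ^ i - 1)) := by
  have hp0 : (p : ℝ) ≠ 0 := by
    have : p ≠ 0 := by rintro rfl; simp at hp
    exact_mod_cast this
  have h1 : ∑ i ∈ Finset.Ioc 0 m, 1 / (((p : ℝ) ^ k)⁻¹ - ((p : ℝ) ^ (k + i))⁻¹)
      = ∑ i ∈ Finset.Ioc 0 m, (p : ℝ) ^ k * (1 + 1 / ((p : ℝ) ^ i - 1)) := by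
    refine Finset.sum_congr rfl fun i hi => ?_
    have := cast_pow_sub_one_ne_zero hp (Finset.mem_Ioc.1 hi).1
    rw [node_sub_node_upper hp, pow_add]
    field_simp
    ring
  have h2 : ∑ i ∈ Finset.Ioc 0 k, 1 / (((p : ℝ) ^ k)⁻¹ - ((p : ℝ) ^ (k - i))⁻¹)
      = ∑ i ∈ Finset.Ioc 0 k, -((p : ℝ) ^ k * (1 / ((p : ℝ) ^ i - 1))) := by
    refine Finset.sum_congr rfl fun i hi => ?_
    have := cast_pow_sub_one_ne_zero hp (Finset.mem_Ioc.1 hi).1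
    rw [node_sub_node_lower hp (Finset.mem_Ioc.1 hi).2]
    field_simp
  rw [sum_range_erase_eq (fun j => 1 / (((p : ℝ) ^ k)⁻¹ - ((p : ℝ) ^ j)⁻¹)), h1, h2,
    ← Finset.mul_sum, Finset.sum_add_distrib, Finset.sum_neg_distrib, ← Finset.mul_sum]
  simp
  ring

/-- Partial fraction decomposition of `summand`. -/
lemma summand_eq_sum (hp : 2 ≤ |p|) (hn : n + 1 = 2 * h) {S : ℝ}
    (hS : ∀ k ≤ n, (p : ℝ) ^ k * S - 1 ≠ 0) :
    summand p n h S = ∑ k ∈ Finset.range (n + 1),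
      (leadCoeff p n h k * ((p : ℝ) ^ k * S / ((p : ℝ) ^ k * S - 1) ^ 2)
        + leadCoeff p n h k * regLogDeriv p n k * (1 / ((p : ℝ) ^ k * S - 1))) := by
  have hp0 : (p : ℝ) ≠ 0 := by
    have : p ≠ 0 := by rintro rfl; simp at hp
    exact_mod_cast this
  have hnode : ∀ k, S - ((p : ℝ) ^ k)⁻¹ = ((p : ℝ) ^ k * S - 1) / (p : ℝ) ^ k := fun k => by
    field_simp
  have hinj : ∀ i ∈ Finset.range (n + 1), ∀ j ∈ Finset.range (n + 1), i ≠ j →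
      ((p : ℝ) ^ i)⁻¹ ≠ ((p : ℝ) ^ j)⁻¹ := by
    intro i _ j _ hij heq
    have h1 : |(p : ℝ)| ^ i = |(p : ℝ)| ^ j := by
      rw [← abs_pow, ← abs_pow, inv_injective heq]
    have hp' : (1 : ℝ) < |(p : ℝ)| := by
      have : (2 : ℝ) ≤ |(p : ℝ)| := by exact_mod_cast hp
      linarith
    exact hij (pow_right_injective₀ (by linarith) hp'.ne' h1)
  have hpf := eval_div_prod_sq_eq_sum (Finset.range (n + 1)) (fun k => ((p : ℝ) ^ k)⁻¹) hinj
    (numPoly p n h) (degree_numPoly_lt _ h (by omega))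
    (fun k => leadCoeff p n h k / (p : ℝ) ^ (2 * k))
    (fun k => leadCoeff p n h k * (1 + regLogDeriv p n k) / (p : ℝ) ^ k)
    (fun k hk => eval_numPoly_node hp hn (by simp at hk; omega))
    (fun k hk => by
      have hk' : k ≤ n := by simp at hk; omega
      rw [eval_derivative_numPoly_node hp, ← eval_numPoly_node hp hn hk']
      obtain ⟨m, rfl⟩ := Nat.exists_eq_add_of_le hk'
      rw [sum_node_sub hp, regLogDeriv, Nat.add_sub_cancel_left]
      rw [pow_mul' (p : ℝ) 2 k]
      field_simp
      ring)
    S (fun k hk => by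
      rw [hnode]
      exact div_ne_zero (hS k (by simp at hk; omega)) (pow_ne_zero _ hp0))
  have hleft : summand p n h S = (numPoly p n h).eval S
      / (∏ k ∈ Finset.range (n + 1), (S - ((p : ℝ) ^ k)⁻¹)) ^ 2 := by
    have hprod : (∏ k ∈ Finset.range (n + 1), (p : ℝ) ^ k) ^ 2 = (p : ℝ) ^ (n * (n + 1)) := by
      rw [Finset.prod_pow_eq_pow_sum, ← pow_mul, Finset.sum_range_id_mul_two, Nat.add_sub_cancel,
        mul_comm]
    rw [Finset.prod_congr rfl fun k _ => hnode k, Finset.prod_div_distrib, div_pow, hprod, numPoly,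
      summand]
    simp only [Polynomial.eval_mul, Polynomial.eval_C, Polynomial.eval_pow, Polynomial.eval_X,
      Polynomial.eval_prod, Polynomial.eval_sub]
    field_simp
  rw [hleft, hpf]
  refine Finset.sum_congr rfl fun k hk => ?_
  have := hS k (by simp at hk; omega)
  rw [hnode, pow_mul' (p : ℝ) 2 k]
  field_simp
  ring

lemma sum_leadCoeff_mul_regLogDeriv (hp : 2 ≤ |p|) (hn : n + 1 = 2 * h) :
    ∑ k ∈ Finset.range (n + 1), leadCoeff p n h k * regLogDeriv p n k = 0 := by
  have h0 := summand_eq_sum hp hn (S := 0) (fun k _ => by simp)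
  simpa [summand] using h0

end PartialFractions

section Integrality

variable {p : ℤ} {n h k : ℕ}

lemma pow_sub_one_eq_prod_cyclotomic (p : ℤ) {i N : ℕ} (hi : 0 < i) (hiN : i ≤ N) :
    p ^ i - 1 = ∏ d ∈ Finset.Ioc 0 N,
      (Polynomial.cyclotomic d ℤ).eval p ^ (if d ∣ i then 1 else 0) := by
  rw [← prod_eval_cyclotomic p hi]
  simp only [pow_ite, pow_one, pow_zero]
  rw [← Finset.prod_filter]
  congr 1
  ext d
  simp only [Nat.mem_divisors, Finset.mem_filter, Finset.mem_Ioc]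
  constructor
  · rintro ⟨h1, h2⟩
    exact ⟨⟨Nat.pos_of_dvd_of_pos h1 hi, (Nat.le_of_dvd hi h1).trans hiN⟩, h1⟩
  · rintro ⟨_, h1⟩
    exact ⟨h1, hi.ne'⟩

lemma powFactorial_eq_prod_cyclotomic (p : ℤ) {m N : ℕ} (hm : m ≤ N) :
    powFactorial p m = ∏ d ∈ Finset.Ioc 0 N, (Polynomial.cyclotomic d ℤ).eval p ^ (m / d) := by
  induction m with
  | zero => simp [powFactorial]
  | succ m ih =>
    rw [powFactorial, ← Finset.insert_Ioc_right_eq_Ioc_add_one (Nat.zero_le m),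
      Finset.prod_insert (by simp), pow_sub_one_eq_prod_cyclotomic p (by omega : 0 < m + 1) hm]
    rw [powFactorial] at ih
    rw [ih (by omega), ← Finset.prod_mul_distrib]
    refine Finset.prod_congr rfl fun d _ => ?_
    rw [← pow_add, Nat.succ_div, add_comm]

lemma cycProd_eq_prod_ite (p : ℤ) {n N : ℕ} (hn : n ≤ N) :
    cycProd p n = ∏ d ∈ Finset.Ioc 0 N,
      (Polynomial.cyclotomic d ℤ).eval p ^ (if d ≤ n then 1 else 0) := by
  simp only [pow_ite, pow_one, pow_zero]
  rw [← Finset.prod_filter, cycProd]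
  congr 1
  ext d
  simp only [Finset.mem_filter, Finset.mem_Ioc]
  omega

lemma pow_sub_one_dvd_cycProd (p : ℤ) {l : ℕ} (hl : 0 < l) (hln : l ≤ n) :
    p ^ l - 1 ∣ cycProd p n := by
  rw [pow_sub_one_eq_prod_cyclotomic p hl hln, cycProd_eq_prod_ite p le_rfl]
  refine Finset.prod_dvd_prod_of_dvd _ _ fun d hd => pow_dvd_pow _ ?_
  rw [if_pos (Finset.mem_Ioc.1 hd).2]
  split_ifs <;> omega

lemma three_mul_div_add_two_mul_div_le (hk : k ≤ n) (d : ℕ) :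
    3 * (k / d) + 2 * ((n - k) / d) ≤ (n + k) / d + n / d := by
  have h1 : k / d + (n - k) / d ≤ (k + (n - k)) / d := Nat.div_add_div_le_add_div
  have h2 : n / d + k / d ≤ (n + k) / d := Nat.div_add_div_le_add_div
  rw [Nat.add_sub_cancel' hk] at h1
  omega

lemma powFactorial_dvd (p : ℤ) (hk : k ≤ n) :
    powFactorial p k ^ 3 * powFactorial p (n - k) ^ 2 ∣
      powFactorial p (n + k) * powFactorial p n := by
  rw [powFactorial_eq_prod_cyclotomic p (m := k) (N := n + k) (by omega),
    powFactorial_eq_prod_cyclotomic p (m := n - k) (N := n + k) (by omega),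
    powFactorial_eq_prod_cyclotomic p (m := n + k) (N := n + k) (by omega),
    powFactorial_eq_prod_cyclotomic p (m := n) (N := n + k) (by omega),
    ← Finset.prod_pow, ← Finset.prod_pow, ← Finset.prod_mul_distrib, ← Finset.prod_mul_distrib]
  refine Finset.prod_dvd_prod_of_dvd _ _ fun d _ => ?_
  rw [← pow_mul, ← pow_mul, ← pow_add, ← pow_add]
  have := three_mul_div_add_two_mul_div_le hk d
  exact pow_dvd_pow _ (by omega)

lemma pow_sub_one_mul_powFactorial_dvd (p : ℤ) (hk : k ≤ n) {l : ℕ} (hl : 0 < l)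
    (hln : l ≤ n + k) :
    (p ^ l - 1) * (powFactorial p k ^ 3 * powFactorial p (n - k) ^ 2) ∣
      cycProd p n * (powFactorial p (n + k) * powFactorial p n) := by
  rw [powFactorial_eq_prod_cyclotomic p (m := k) (N := n + k) (by omega),
    powFactorial_eq_prod_cyclotomic p (m := n - k) (N := n + k) (by omega),
    powFactorial_eq_prod_cyclotomic p (m := n + k) (N := n + k) (by omega),
    powFactorial_eq_prod_cyclotomic p (m := n) (N := n + k) (by omega),
    pow_sub_one_eq_prod_cyclotomic p hl hln,
    cycProd_eq_prod_ite p (N := n + k) (by omega : n ≤ n + k),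
    ← Finset.prod_pow, ← Finset.prod_pow, ← Finset.prod_mul_distrib, ← Finset.prod_mul_distrib,
    ← Finset.prod_mul_distrib, ← Finset.prod_mul_distrib]
  refine Finset.prod_dvd_prod_of_dvd _ _ fun d hd => ?_
  rw [← pow_mul, ← pow_mul, ← pow_add, ← pow_add, ← pow_add, ← pow_add]
  have h1 := three_mul_div_add_two_mul_div_le hk d
  refine pow_dvd_pow _ ?_
  rcases le_or_gt d n with hdn | hdn
  · rw [if_pos hdn]
    split_ifs <;> omega
  · have h2 : k / d = 0 := Nat.div_eq_of_lt (by omega)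
    have h3 : (n - k) / d = 0 := Nat.div_eq_of_lt (by omega)
    have h5 : n / d = 0 := Nat.div_eq_of_lt hdn
    have h4 : 1 ≤ (n + k) / d :=
      (Nat.one_le_div_iff (Finset.mem_Ioc.1 hd).1).2 (Finset.mem_Ioc.1 hd).2
    split_ifs <;> omega

/-- The integers as a subring of the reals. -/
def realInts : Subring ℝ := (Int.castRingHom ℝ).range

lemma intCast_mem_realInts (z : ℤ) : (z : ℝ) ∈ realInts := ⟨z, rfl⟩

lemma leadCoeff_mem_realInts (hp : 2 ≤ |p|) (hk : k ≤ n) : leadCoeff p n h k ∈ realInts := by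
  obtain ⟨z, hz⟩ := powFactorial_dvd p hk
  have hFk := cast_powFactorial_ne_zero hp k
  have hFm := cast_powFactorial_ne_zero hp (n - k)
  have hz' := congrArg (Int.cast : ℤ → ℝ) hz
  push_cast [cast_powFactorial] at hz'
  refine ⟨(-1) ^ n * p ^ (((k : ℤ) - h).natAbs ^ 2) * z, ?_⟩
  rw [leadCoeff, hz']
  simp only [eq_intCast]
  push_cast
  field_simp

lemma cycProd_mul_leadCoeff_div_mem_realInts (hp : 2 ≤ |p|) (hk : k ≤ n) {l : ℕ} (hl : 0 < l)
    (hln : l ≤ n + k) :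
    cycProd p n * leadCoeff p n h k * (1 / ((p : ℝ) ^ l - 1)) ∈ realInts := by
  obtain ⟨z, hz⟩ := pow_sub_one_mul_powFactorial_dvd p hk hl hln
  have hFk := cast_powFactorial_ne_zero hp k
  have hFm := cast_powFactorial_ne_zero hp (n - k)
  have hz' := congrArg (Int.cast : ℤ → ℝ) hz
  have hl' := cast_pow_sub_one_ne_zero hp hl
  push_cast [cast_powFactorial] at hz'
  refine ⟨(-1) ^ n * p ^ (((k : ℤ) - h).natAbs ^ 2) * z, ?_⟩
  have : (cycProd p n : ℝ) * leadCoeff p n h k * (1 / ((p : ℝ) ^ l - 1))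
      = (-1) ^ n * (p : ℝ) ^ (((k : ℤ) - h).natAbs ^ 2) * ((cycProd p n : ℝ)
        * (powFactorial (p : ℝ) (n + k) * powFactorial (p : ℝ) n))
        / (((p : ℝ) ^ l - 1) * (powFactorial (p : ℝ) k ^ 3 * powFactorial (p : ℝ) (n - k) ^ 2)) := by
    rw [leadCoeff]
    field_simp
  rw [this, hz']
  simp only [eq_intCast]
  push_cast
  field_simp

lemma cycProd_div_mem_realInts (hp : 2 ≤ |p|) {l : ℕ} (hl : 0 < l) (hln : l ≤ n) :
    (cycProd p n : ℝ) * (1 / ((p : ℝ) ^ l - 1)) ∈ realInts := by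
  obtain ⟨z, hz⟩ := pow_sub_one_dvd_cycProd p hl hln
  have hl' := cast_pow_sub_one_ne_zero hp hl
  refine ⟨z, ?_⟩
  rw [hz]
  simp only [eq_intCast]
  push_cast
  field_simp

lemma cycProd_mul_leadCoeff_mul_regLogDeriv_mem_realInts (hp : 2 ≤ |p|) (hk : k ≤ n) :
    cycProd p n * (leadCoeff p n h k * regLogDeriv p n k) ∈ realInts := by
  have hD := intCast_mem_realInts (cycProd p n)
  have ha := leadCoeff_mem_realInts (h := h) hp hk
  have h1 : ∑ i ∈ Finset.Ioc 0 n, (cycProd p n : ℝ) * leadCoeff p n h k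
      * (1 / ((p : ℝ) ^ (k + i) - 1)) ∈ realInts := sum_mem fun i hi => by
    have := Finset.mem_Ioc.1 hi
    exact cycProd_mul_leadCoeff_div_mem_realInts hp hk (by omega) (by omega)
  have h2 : ∀ m ≤ n, ∑ i ∈ Finset.Ioc 0 m, (cycProd p n : ℝ) * (1 / ((p : ℝ) ^ i - 1)) ∈ realInts :=
    fun m hm => sum_mem fun i hi => by
      have := Finset.mem_Ioc.1 hi
      exact cycProd_div_mem_realInts hp (by omega) (by omega)
  rw [← Finset.mul_sum] at h1
  have h3 := h2 k hk
  have h4 := h2 (n - k) (Nat.sub_le _ _)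
  rw [← Finset.mul_sum] at h3 h4
  have h5 := intCast_mem_realInts (1 - 2 * ((n - k : ℕ) : ℤ))
  have h6 := intCast_mem_realInts 2
  push_cast at h5 h6
  have key := add_mem (add_mem (sub_mem (mul_mem (mul_mem hD ha) h5) h1)
    (mul_mem h6 (mul_mem ha h3))) (neg_mem (mul_mem h6 (mul_mem ha h4)))
  convert key using 1
  rw [regLogDeriv]
  ring

/-- The coefficient of `ζ_q(2)` in the linear form. -/
noncomputable def formCoeff (p : ℝ) (n h : ℕ) : ℝ := ∑ k ∈ Finset.range (n + 1), leadCoeff p n h k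

/-- The rational part of the linear form. -/
noncomputable def formConst (p : ℝ) (n h : ℕ) : ℝ :=
  ∑ k ∈ Finset.range (n + 1),
    (leadCoeff p n h k * ∑ l ∈ Finset.Ioc 0 k, p ^ l / (p ^ l - 1) ^ 2
      + leadCoeff p n h k * regLogDeriv p n k * ∑ l ∈ Finset.Ioc 0 k, 1 / (p ^ l - 1))

lemma formCoeff_mem_realInts (hp : 2 ≤ |p|) : formCoeff p n h ∈ realInts :=
  sum_mem fun _ hk => leadCoeff_mem_realInts hp (Nat.lt_succ_iff.1 (Finset.mem_range.1 hk))

lemma cycProd_sq_mul_formConst_mem_realInts (hp : 2 ≤ |p|) :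
    (cycProd p n : ℝ) ^ 2 * formConst p n h ∈ realInts := by
  rw [formConst, Finset.mul_sum]
  refine sum_mem fun k hk => ?_
  have hk' : k ≤ n := Nat.lt_succ_iff.1 (Finset.mem_range.1 hk)
  have hdiv : ∀ l ∈ Finset.Ioc 0 k, (cycProd p n : ℝ) * (1 / ((p : ℝ) ^ l - 1)) ∈ realInts :=
    fun l hl => by
      have := Finset.mem_Ioc.1 hl
      exact cycProd_div_mem_realInts hp (by omega) (by omega)
  have h1 : ∑ l ∈ Finset.Ioc 0 k, (p : ℝ) ^ l
      * ((cycProd p n : ℝ) * (1 / ((p : ℝ) ^ l - 1))) ^ 2 ∈ realInts := sum_mem fun l hl =>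
    mul_mem (pow_mem (intCast_mem_realInts p) l) (pow_mem (hdiv l hl) 2)
  have h2 : ∑ l ∈ Finset.Ioc 0 k, (cycProd p n : ℝ) * (1 / ((p : ℝ) ^ l - 1)) ∈ realInts :=
    sum_mem hdiv
  have key := add_mem (mul_mem (leadCoeff_mem_realInts (h := h) hp hk') h1)
    (mul_mem (cycProd_mul_leadCoeff_mul_regLogDeriv_mem_realInts (h := h) hp hk') h2)
  convert key using 1
  have e1 : ∑ l ∈ Finset.Ioc 0 k, (p : ℝ) ^ l * ((cycProd p n : ℝ) * (1 / ((p : ℝ) ^ l - 1))) ^ 2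
      = (cycProd p n : ℝ) ^ 2 * ∑ l ∈ Finset.Ioc 0 k, (p : ℝ) ^ l / ((p : ℝ) ^ l - 1) ^ 2 := by
    rw [Finset.mul_sum]
    refine Finset.sum_congr rfl fun l _ => ?_
    rw [mul_pow, div_pow, one_pow]
    ring
  rw [e1, ← Finset.mul_sum]
  ring

end Integrality

/-- A series vanishing up to index `n` and then decaying by a factor `4` is close to its
first nonzero term. -/
lemma abs_tsum_sub_le_of_ratio {f : ℕ → ℝ} {n : ℕ} (h0 : ∀ s < n, f s = 0)
    (hr : ∀ s, n ≤ s → |f (s + 1)| ≤ |f s| / 4) :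
    |∑' s, f s - f n| ≤ |f n| / 3 := by
  have hb : ∀ i, |f (i + n)| ≤ |f n| * (1 / 4) ^ i := by
    intro i
    induction i with
    | zero => simp
    | succ i ih =>
      have := hr (i + n) (by omega)
      rw [show i + 1 + n = i + n + 1 by ring, pow_succ]
      linarith
  have hg : Summable fun i : ℕ => |f n| * (1 / 4 : ℝ) ^ i :=
    (summable_geometric_of_lt_one (by norm_num) (by norm_num)).mul_left _
  have hs : Summable fun i => f (i + n) := Summable.of_norm_bounded hg hb
  have hs' : Summable f := (summable_nat_add_iff n).1 hs
  have e1 := hs'.sum_add_tsum_nat_add n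
  rw [Finset.sum_eq_zero fun s hs => h0 s (Finset.mem_range.1 hs), zero_add, hs.tsum_eq_zero_add,
    zero_add] at e1
  rw [← e1, add_sub_cancel_left]
  have hg1 : HasSum (fun i : ℕ => |f n| * (1 / 4 : ℝ) ^ (i + 1)) (|f n| / 3) := by
    have := ((hasSum_geometric_of_lt_one (r := (1 / 4 : ℝ)) (by norm_num) (by norm_num)).mul_left
      (|f n| * (1 / 4)))
    have e2 : |f n| * (1 / 4) * (1 - 1 / 4)⁻¹ = |f n| / 3 := by norm_num; ring
    rw [e2] at this
    rwa [funext fun i : ℕ => show |f n| * (1 / 4) * (1 / 4 : ℝ) ^ i = |f n| * (1 / 4) ^ (i + 1) by ring] at this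
  exact tsum_of_norm_bounded (f := fun i => f (i + 1 + n)) hg1 fun i => hb (i + 1)

section Series

variable {p : ℤ} {n h : ℕ}

lemma abs_one_div_lt_one (hp : 2 ≤ |p|) : |1 / (p : ℝ)| < 1 := by
  have hp' : (2 : ℝ) ≤ |(p : ℝ)| := by exact_mod_cast hp
  rw [abs_div, abs_one, div_lt_one (by linarith)]
  linarith

/-- `ζ_q(2)` as a Lambert series in `p = 1 / q`. -/
lemma qZeta_two_eq_tsum (hp : 2 ≤ |p|) :
    qZeta (1 / (p : ℝ)) 2 = ∑' s : ℕ, (p : ℝ) ^ (s + 1) / ((p : ℝ) ^ (s + 1) - 1) ^ 2 := by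
  have hp0 : (p : ℝ) ≠ 0 := by
    have : p ≠ 0 := by rintro rfl; simp at hp
    exact_mod_cast this
  have hr := abs_one_div_lt_one hp
  set r : ℝ := 1 / (p : ℝ) with hrdef
  have h1 := tsum_prod_pow_eq_tsum_sigma 1 (r := r) (by rwa [Real.norm_eq_abs])
  have h2 : qZeta r 2 = ∑' e : ℕ+, (ArithmeticFunction.sigma 1 (e : ℕ) : ℝ) * r ^ (e : ℕ) := by
    rw [qZeta, tsum_pnat_eq_tsum_of_eq_zero (f := fun n : ℕ => (ArithmeticFunction.sigma 1 n : ℝ) * r ^ n) (by simp)]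
  rw [h2, ← h1, ← tsum_pnat_eq_tsum_succ
    (f := fun s => (p : ℝ) ^ s / ((p : ℝ) ^ s - 1) ^ 2)]
  refine tsum_congr fun d => ?_
  have hd : ‖r ^ (d : ℕ)‖ < 1 := by
    rw [norm_pow, Real.norm_eq_abs]
    exact pow_lt_one₀ (abs_nonneg _) hr d.ne_zero
  have h3 := tsum_coe_mul_geometric_of_norm_lt_one hd
  rw [← tsum_pnat_eq_tsum_of_eq_zero (f := fun n : ℕ => (n : ℝ) * (r ^ (d : ℕ)) ^ n) (by simp)] at h3
  have h4 : ∀ c : ℕ+, ((c : ℕ) : ℝ) ^ 1 * r ^ ((d : ℕ) * (c : ℕ))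
      = ((c : ℕ) : ℝ) * (r ^ (d : ℕ)) ^ (c : ℕ) := fun c => by rw [pow_one, pow_mul]
  rw [tsum_congr h4, h3, hrdef]
  have hne := cast_pow_sub_one_ne_zero hp d.pos
  rw [div_pow, one_pow]
  field_simp

lemma summable_one_div_abs_pow (hp : 2 ≤ |p|) : Summable fun s : ℕ => 1 / |(p : ℝ)| ^ (s + 1) := by
  have := (summable_geometric_of_lt_one (abs_nonneg _) (abs_one_div_lt_one hp)).mul_left
    |1 / (p : ℝ)|
  refine this.congr fun s => ?_
  rw [← pow_succ', abs_div, abs_one, div_pow, one_pow]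

lemma summable_one_div_pow_sub_one (hp : 2 ≤ |p|) :
    Summable fun s : ℕ => 1 / ((p : ℝ) ^ (s + 1) - 1) := by
  refine Summable.of_norm_bounded ((summable_one_div_abs_pow hp).mul_left 2) fun s => ?_
  have h1 := abs_pow_sub_one_lower hp (Nat.succ_pos s)
  have hp' : (2 : ℝ) ≤ |(p : ℝ)| := by exact_mod_cast hp
  have h2 : 0 < |(p : ℝ)| ^ (s + 1) := by positivity
  rw [Real.norm_eq_abs, abs_div, abs_one]
  calc 1 / |(p : ℝ) ^ (s + 1) - 1| ≤ 1 / (|(p : ℝ)| ^ (s + 1) / 2) :=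
        one_div_le_one_div_of_le (by positivity) h1
    _ = 2 * (1 / |(p : ℝ)| ^ (s + 1)) := by field_simp

lemma summable_pow_div_pow_sub_one_sq (hp : 2 ≤ |p|) :
    Summable fun s : ℕ => (p : ℝ) ^ (s + 1) / ((p : ℝ) ^ (s + 1) - 1) ^ 2 := by
  refine Summable.of_norm_bounded ((summable_one_div_abs_pow hp).mul_left 4) fun s => ?_
  have h1 := abs_pow_sub_one_lower hp (Nat.succ_pos s)
  have hp' : (2 : ℝ) ≤ |(p : ℝ)| := by exact_mod_cast hp
  have h2 : 0 < |(p : ℝ)| ^ (s + 1) := by positivity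
  rw [Real.norm_eq_abs, abs_div, abs_pow, abs_pow]
  calc |(p : ℝ)| ^ (s + 1) / |(p : ℝ) ^ (s + 1) - 1| ^ 2
        ≤ |(p : ℝ)| ^ (s + 1) / (|(p : ℝ)| ^ (s + 1) / 2) ^ 2 := by gcongr
    _ = 4 * (1 / |(p : ℝ)| ^ (s + 1)) := by field_simp; norm_num

lemma sum_Ioc_zero_eq_sum_range (f : ℕ → ℝ) (k : ℕ) :
    ∑ l ∈ Finset.Ioc 0 k, f l = ∑ i ∈ Finset.range k, f (i + 1) := by
  induction k with
  | zero => simp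
  | succ k ih =>
    rw [← Finset.insert_Ioc_right_eq_Ioc_add_one (Nat.zero_le k), Finset.sum_insert (by simp), ih,
      Finset.sum_range_succ, add_comm]

lemma hasSum_shift {f : ℕ → ℝ} (hf : Summable fun s => f (s + 1)) (k : ℕ) :
    HasSum (fun s => f (k + (s + 1))) (∑' s, f (s + 1) - ∑ l ∈ Finset.Ioc 0 k, f l) := by
  have h1 := (hasSum_nat_add_iff' k).2 hf.hasSum
  rw [sum_Ioc_zero_eq_sum_range]
  rwa [funext fun s => show f (s + k + 1) = f (k + (s + 1)) by congr 1; ring] at h1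

/-- The series of `summand` is a linear form in `1` and `ζ_q(2)`. -/
lemma tsum_summand_eq (hp : 2 ≤ |p|) (hn : n + 1 = 2 * h) :
    ∑' s : ℕ, summand p n h ((p : ℝ) ^ (s + 1))
      = formCoeff p n h * qZeta (1 / (p : ℝ)) 2 - formConst p n h := by
  set Z₁ := ∑' s : ℕ, 1 / ((p : ℝ) ^ (s + 1) - 1) with hZ₁
  have hterm : ∀ s : ℕ, summand p n h ((p : ℝ) ^ (s + 1)) = ∑ k ∈ Finset.range (n + 1),
      (leadCoeff p n h k * ((p : ℝ) ^ (k + (s + 1)) / ((p : ℝ) ^ (k + (s + 1)) - 1) ^ 2)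
        + leadCoeff p n h k * regLogDeriv p n k * (1 / ((p : ℝ) ^ (k + (s + 1)) - 1))) := by
    intro s
    rw [summand_eq_sum hp hn fun k _ => by
      rw [← pow_add]; exact cast_pow_sub_one_ne_zero hp (by omega)]
    simp only [← pow_add]
  have hsum : HasSum (fun s : ℕ => summand p n h ((p : ℝ) ^ (s + 1)))
      (∑ k ∈ Finset.range (n + 1), (leadCoeff p n h k * (qZeta (1 / (p : ℝ)) 2
          - ∑ l ∈ Finset.Ioc 0 k, (p : ℝ) ^ l / ((p : ℝ) ^ l - 1) ^ 2)
        + leadCoeff p n h k * regLogDeriv p n k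
          * (Z₁ - ∑ l ∈ Finset.Ioc 0 k, 1 / ((p : ℝ) ^ l - 1)))) := by
    simp only [hterm]
    refine hasSum_sum fun k _ => ?_
    rw [qZeta_two_eq_tsum hp]
    exact ((hasSum_shift (f := fun l => (p : ℝ) ^ l / ((p : ℝ) ^ l - 1) ^ 2)
      (summable_pow_div_pow_sub_one_sq hp) k).mul_left _).add
      ((hasSum_shift (f := fun l => 1 / ((p : ℝ) ^ l - 1))
        (summable_one_div_pow_sub_one hp) k).mul_left _)
  rw [hsum.tsum_eq, formCoeff, formConst, Finset.sum_mul, ← Finset.sum_sub_distrib]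
  have h0 := congrArg (· * Z₁) (sum_leadCoeff_mul_regLogDeriv hp hn)
  simp only [Finset.sum_mul, zero_mul] at h0
  rw [← sub_eq_zero, ← Finset.sum_sub_distrib, ← h0]
  refine Finset.sum_congr rfl fun k _ => ?_
  ring

lemma prod_mul_sub_pow (p S : ℝ) (n : ℕ) :
    (∏ i ∈ Finset.Ioc 0 n, (p * S - p ^ i)) * (S - p ^ n)
      = p ^ n * (S - 1) * ∏ i ∈ Finset.Ioc 0 n, (S - p ^ i) := by
  induction n with
  | zero => simp
  | succ n ih =>
    rw [← Finset.insert_Ioc_right_eq_Ioc_add_one (Nat.zero_le n), Finset.prod_insert (by simp),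
      Finset.prod_insert (by simp)]
    linear_combination p * (S - p ^ (n + 1)) * ih

lemma prod_pow_mul_sub_one (p S : ℝ) (n : ℕ) :
    (∏ k ∈ Finset.range (n + 1), (p ^ k * (p * S) - 1)) * (S - 1)
      = (∏ k ∈ Finset.range (n + 1), (p ^ k * S - 1)) * (p ^ (n + 1) * S - 1) := by
  rw [← Finset.prod_range_succ (fun k => p ^ k * S - 1) (n + 1),
    Finset.prod_range_succ' (fun k => p ^ k * S - 1) (n + 1)]
  simp only [pow_zero, one_mul]
  congr 1
  refine Finset.prod_congr rfl fun k _ => ?_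
  ring

lemma summand_mul_eq {p S : ℝ} {n : ℕ} (h : ℕ) (h1 : S - 1 ≠ 0) (hS : S - p ^ n ≠ 0)
    (hQ : ∀ k ≤ n + 1, p ^ k * S - 1 ≠ 0) :
    summand p n h (p * S)
      = p ^ (n + 2) * (S - 1) ^ 3 / ((S - p ^ n) * (p ^ (n + 1) * S - 1) ^ 2)
        * summand p n h S := by
  have e1 := prod_mul_sub_pow p S n
  have e2 := prod_pow_mul_sub_one p S n
  have hn1 := hQ (n + 1) le_rfl
  have hQ' : ∏ k ∈ Finset.range (n + 1), (p ^ k * S - 1) ≠ 0 :=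
    Finset.prod_ne_zero_iff.2 fun k hk => hQ k (Finset.mem_range.1 hk).le
  rw [summand, summand, eq_div_of_mul_eq hS e1, eq_div_of_mul_eq h1 e2, pow_add p n 2]
  field_simp

lemma abs_summand_succ_le (hp : 2 ≤ |p|) (hn : 7 ≤ n) (h : ℕ) {l : ℕ} (hl : n + 1 ≤ l) :
    |summand p n h ((p : ℝ) ^ (l + 1))| ≤ |summand p n h ((p : ℝ) ^ l)| / 4 := by
  have hp' : (2 : ℝ) ≤ |(p : ℝ)| := by exact_mod_cast hp
  set P := |(p : ℝ)| with hP
  set S := (p : ℝ) ^ l with hS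
  have hSabs : |S| = P ^ l := abs_pow _ _
  have hPn : P ^ n * 2 ≤ |S| := by
    rw [hSabs]
    calc P ^ n * 2 ≤ P ^ n * P := by gcongr
      _ = P ^ (n + 1) := (pow_succ _ _).symm
      _ ≤ P ^ l := pow_le_pow_right₀ (by linarith) hl
  have hPn128 : (128 : ℝ) ≤ P ^ n := by
    calc (128 : ℝ) = 2 ^ 7 := by norm_num
      _ ≤ 2 ^ n := pow_le_pow_right₀ (by norm_num) hn
      _ ≤ P ^ n := by gcongr
  have hS0 : 0 < |S| := by linarith
  have b1 : |S - 1| ≤ 3 / 2 * |S| := by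
    have := abs_sub S 1
    rw [abs_one] at this
    linarith
  have b2 : |S| / 2 ≤ |S - (p : ℝ) ^ n| := by
    have := abs_sub_abs_le_abs_sub S ((p : ℝ) ^ n)
    rw [hSabs, abs_pow (p : ℝ) n, ← hP] at this
    linarith
  have b3 : P ^ (n + 1) * |S| / 2 ≤ |(p : ℝ) ^ (n + 1) * S - 1| := by
    have := abs_pow_sub_one_lower hp (m := n + 1 + l) (by omega)
    rwa [pow_add _ (n + 1) l, pow_add _ (n + 1) l, ← hP, ← hSabs] at this
  rw [pow_succ', summand_mul_eq h (cast_pow_sub_one_ne_zero hp (by omega))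
    (by rw [← abs_pos]; linarith)
    (fun k _ => by rw [← pow_add]; exact cast_pow_sub_one_ne_zero hp (by omega)), abs_mul]
  have hratio : |(p : ℝ) ^ (n + 2) * (S - 1) ^ 3
      / ((S - (p : ℝ) ^ n) * ((p : ℝ) ^ (n + 1) * S - 1) ^ 2)| ≤ 1 / 4 := by
    rw [abs_div, abs_mul, abs_mul, abs_pow, abs_pow, abs_pow, ← hP]
    calc P ^ (n + 2) * |S - 1| ^ 3 / (|S - (p : ℝ) ^ n| * |(p : ℝ) ^ (n + 1) * S - 1| ^ 2)
        ≤ P ^ (n + 2) * (3 / 2 * |S|) ^ 3 / (|S| / 2 * (P ^ (n + 1) * |S| / 2) ^ 2) := by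
          gcongr
      _ = 27 / P ^ n := by
          field_simp
          ring
      _ ≤ 1 / 4 := by
          rw [div_le_div_iff₀ (by positivity) (by norm_num)]
          linarith
  calc _ ≤ 1 / 4 * |summand p n h S| := mul_le_mul_of_nonneg_right hratio (abs_nonneg _)
    _ = _ := by ring

lemma summand_eq_zero (h : ℕ) {l : ℕ} (hl : 0 < l) (hln : l ≤ n) :
    summand p n h ((p : ℝ) ^ l) = 0 := by
  rw [summand, Finset.prod_eq_zero (Finset.mem_Ioc.2 ⟨hl, hln⟩) (sub_self _)]
  simp

/-- The linear form is comparable with the first nonzero term of its series. -/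
lemma abs_linearForm_sub_le (hp : 2 ≤ |p|) (hn : n + 1 = 2 * h) (hn7 : 7 ≤ n) :
    |formCoeff p n h * qZeta (1 / (p : ℝ)) 2 - formConst p n h
      - summand p n h ((p : ℝ) ^ (n + 1))| ≤ |summand p n h ((p : ℝ) ^ (n + 1))| / 3 := by
  rw [← tsum_summand_eq hp hn]
  exact abs_tsum_sub_le_of_ratio (f := fun s => summand p n h ((p : ℝ) ^ (s + 1)))
    (fun s hs => summand_eq_zero h (by omega) (by omega))
    (fun s hs => abs_summand_succ_le hp hn7 h (by omega))

end Series

section Sizes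

variable {p : ℤ} {n h k : ℕ}

lemma sum_Ioc_natCast (m : ℕ) : ∑ i ∈ Finset.Ioc 0 m, (i : ℝ) = (m : ℝ) * (m + 1) / 2 :=
  sum_Ioc_realId m

lemma abs_log_powFactorial_sub (hp : 2 ≤ |p|) (m : ℕ) :
    |Real.log |powFactorial (p : ℝ) m|
      - (m : ℝ) * (m + 1) / 2 * Real.log (|(p : ℝ)|)| ≤ 4 := by
  have hlog : Real.log |powFactorial (p : ℝ) m|
      = ∑ i ∈ Finset.Ioc 0 m, Real.log |(p : ℝ) ^ i - 1| := by
    rw [powFactorial, Finset.abs_prod, Real.log_prod]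
    exact fun i hi => abs_ne_zero.2 (cast_pow_sub_one_ne_zero hp (Finset.mem_Ioc.1 hi).1)
  rw [hlog, ← sum_Ioc_natCast, Finset.sum_mul, ← Finset.sum_sub_distrib]
  calc _ ≤ ∑ i ∈ Finset.Ioc 0 m,
        |Real.log |(p : ℝ) ^ i - 1| - i * Real.log (|(p : ℝ)|)| := Finset.abs_sum_le_sum_abs _ _
    _ ≤ ∑ i ∈ Finset.Ioc 0 m, 2 * (1 / 2 : ℝ) ^ i := Finset.sum_le_sum fun i hi =>
        abs_log_pow_sub_one_sub hp (Finset.mem_Ioc.1 hi).1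
    _ ≤ ∑' i : ℕ, 2 * (1 / 2 : ℝ) ^ i :=
      (summable_geometric_two.mul_left 2).sum_le_tsum _ fun _ _ => by positivity
    _ = 4 := by rw [tsum_mul_left, tsum_geometric_two]; norm_num

lemma prod_pow_succ_sub_pow (p : ℝ) (n : ℕ) :
    ∏ i ∈ Finset.Ioc 0 n, (p ^ (n + 1) - p ^ i) = (∏ i ∈ Finset.Ioc 0 n, p ^ i) * powFactorial p n := by
  have h1 : powFactorial p n = ∏ i ∈ Finset.Ioc 0 n, (p ^ (n + 1 - i) - 1) :=
    Finset.prod_nbij' (fun i => n + 1 - i) (fun i => n + 1 - i)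
      (fun i hi => by simp at hi ⊢; omega) (fun i hi => by simp at hi ⊢; omega)
      (fun i hi => by simp at hi ⊢; omega) (fun i hi => by simp at hi ⊢; omega)
      (fun i hi => by
        have := Finset.mem_Ioc.1 hi
        rw [show n + 1 - (n + 1 - i) = i by omega])
  rw [h1, ← Finset.prod_mul_distrib]
  refine Finset.prod_congr rfl fun i hi => ?_
  have := Finset.mem_Ioc.1 hi
  rw [mul_sub, ← pow_add, show i + (n + 1 - i) = n + 1 by omega, mul_one]

lemma summand_first_eq (hp : 2 ≤ |p|) (n h : ℕ) :
    summand p n h ((p : ℝ) ^ (n + 1)) = (p : ℝ) ^ (h ^ 2 + 2 * (n + 1) + ∑ i ∈ Finset.Ioc 0 n, i)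
      * powFactorial (p : ℝ) n ^ 4 / powFactorial (p : ℝ) (2 * n + 1) ^ 2 := by
  have hF := cast_powFactorial_ne_zero hp n
  have hF2 := cast_powFactorial_ne_zero hp (2 * n + 1)
  have h1 : powFactorial (p : ℝ) (2 * n + 1) = powFactorial (p : ℝ) n
      * ∏ k ∈ Finset.range (n + 1), ((p : ℝ) ^ k * (p : ℝ) ^ (n + 1) - 1) := by
    rw [show 2 * n + 1 = n + 1 + n by ring, powFactorial_add]
    congr 1
    refine Finset.prod_nbij' (fun i => i - 1) (fun i => i + 1)
      (fun i hi => by simp at hi ⊢; omega) (fun i hi => by simp at hi ⊢; omega)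
      (fun i hi => by simp at hi ⊢; omega) (fun i hi => by simp at hi ⊢)
      (fun i hi => ?_)
    have := Finset.mem_Ioc.1 hi
    rw [← pow_add, show i - 1 + (n + 1) = n + i by omega]
  have h2 : ∏ k ∈ Finset.range (n + 1), ((p : ℝ) ^ k * (p : ℝ) ^ (n + 1) - 1) ≠ 0 := by
    intro h0
    rw [h0, mul_zero] at h1
    exact hF2 h1
  rw [summand, prod_pow_succ_sub_pow, h1, Finset.prod_pow_eq_pow_sum,
    pow_add (p : ℝ) (h ^ 2 + 2 * (n + 1)), pow_add (p : ℝ) (h ^ 2), pow_mul' (p : ℝ) 2 (n + 1)]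
  field_simp

lemma log_abs_cast_nonneg (hp : 2 ≤ |p|) : 0 < Real.log (|(p : ℝ)|) := by
  have hp' : (2 : ℝ) ≤ |(p : ℝ)| := by exact_mod_cast hp
  exact Real.log_pos (by linarith)

lemma summand_first_ne_zero (hp : 2 ≤ |p|) (n h : ℕ) :
    summand p n h ((p : ℝ) ^ (n + 1)) ≠ 0 := by
  have hp0 : (p : ℝ) ≠ 0 := by
    have : p ≠ 0 := by rintro rfl; simp at hp
    exact_mod_cast this
  have hF := cast_powFactorial_ne_zero hp n
  have hF2 := cast_powFactorial_ne_zero hp (2 * n + 1)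
  rw [summand_first_eq hp]
  positivity

lemma abs_log_summand_first_sub (hp : 2 ≤ |p|) (hn : n + 1 = 2 * h) :
    |Real.log |summand p n h ((p : ℝ) ^ (n + 1))|
      - (-5 * (h : ℝ) ^ 2 + 3 * h) * Real.log (|(p : ℝ)|)| ≤ 24 := by
  have hp0 : (p : ℝ) ≠ 0 := by
    have : p ≠ 0 := by rintro rfl; simp at hp
    exact_mod_cast this
  have hF := cast_powFactorial_ne_zero hp n
  have hF2 := cast_powFactorial_ne_zero hp (2 * n + 1)
  have e1 := abs_log_powFactorial_sub hp n
  have e2 := abs_log_powFactorial_sub hp (2 * n + 1)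
  set L := Real.log (|(p : ℝ)|)
  have hlog : Real.log |summand p n h ((p : ℝ) ^ (n + 1))|
      = ((h : ℝ) ^ 2 + 2 * (n + 1) + (n : ℝ) * (n + 1) / 2) * L
        + 4 * Real.log |powFactorial (p : ℝ) n|
        - 2 * Real.log |powFactorial (p : ℝ) (2 * n + 1)| := by
    rw [summand_first_eq hp, abs_div, abs_mul, abs_pow, abs_pow, abs_pow,
      Real.log_div (by positivity) (by positivity), Real.log_mul (by positivity) (by positivity),
      Real.log_pow, Real.log_pow, Real.log_pow, ← sum_Ioc_natCast]
    push_cast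
    ring
  have hn' : (n : ℝ) = 2 * h - 1 := by
    have : (n : ℝ) + 1 = 2 * h := by exact_mod_cast hn
    linarith
  push_cast at e2
  rw [abs_le] at e1 e2 ⊢
  have key : (-5 * (h : ℝ) ^ 2 + 3 * h) * L
      = ((h : ℝ) ^ 2 + 2 * (n + 1) + (n : ℝ) * (n + 1) / 2) * L
        + 4 * ((n : ℝ) * (n + 1) / 2 * L)
        - 2 * ((2 * (n : ℝ) + 1) * (2 * (n : ℝ) + 1 + 1) / 2 * L) := by
    rw [hn']; ring
  rw [hlog, key]
  constructor <;> linarith [e1.1, e1.2, e2.1, e2.2]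

lemma abs_leadCoeff_le (hp : 2 ≤ |p|) (hn : n + 1 = 2 * h) (hk : k ≤ n) :
    |leadCoeff p n h k| ≤ Real.exp (5 * Real.log (|(p : ℝ)|) * (h : ℝ) ^ 2 + 28) := by
  have hp0 : (p : ℝ) ≠ 0 := by
    have : p ≠ 0 := by rintro rfl; simp at hp
    exact_mod_cast this
  have hL := log_abs_cast_nonneg hp
  have hF1 := cast_powFactorial_ne_zero hp n
  have hF2 := cast_powFactorial_ne_zero hp (n + k)
  have hF3 := cast_powFactorial_ne_zero hp k
  have hF4 := cast_powFactorial_ne_zero hp (n - k)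
  have e1 := abs_log_powFactorial_sub hp n
  have e2 := abs_log_powFactorial_sub hp (n + k)
  have e3 := abs_log_powFactorial_sub hp k
  have e4 := abs_log_powFactorial_sub hp (n - k)
  set L := Real.log (|(p : ℝ)|)
  have he : ((((k : ℤ) - h).natAbs ^ 2 : ℕ) : ℝ) + k * (n - k + 1) = (h : ℝ) ^ 2 := by
    have := congrArg (Nat.cast : ℕ → ℝ) (natAbs_sub_sq_add hn hk)
    push_cast [Nat.cast_sub hk] at this ⊢
    exact this
  have hne : leadCoeff p n h k ≠ 0 := by
    rw [leadCoeff]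
    exact div_ne_zero (mul_ne_zero (mul_ne_zero (pow_ne_zero _ (by norm_num))
      (pow_ne_zero _ hp0)) (mul_ne_zero hF2 hF1))
      (mul_ne_zero (pow_ne_zero _ hF3) (pow_ne_zero _ hF4))
  rw [← Real.log_le_iff_le_exp (abs_pos.2 hne)]
  have hlog : Real.log |leadCoeff p n h k| = ((((k : ℤ) - h).natAbs ^ 2 : ℕ) : ℝ) * L
      + (Real.log |powFactorial (p : ℝ) (n + k)| + Real.log |powFactorial (p : ℝ) n|)
      - (3 * Real.log |powFactorial (p : ℝ) k| + 2 * Real.log |powFactorial (p : ℝ) (n - k)|) := by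
    rw [leadCoeff, abs_div, abs_mul, abs_mul, abs_mul, abs_mul, abs_pow, abs_neg, abs_one, one_pow,
      one_mul, abs_pow, abs_pow, abs_pow,
      Real.log_div (by positivity) (by positivity), Real.log_mul (by positivity) (by positivity),
      Real.log_mul (by positivity) (by positivity), Real.log_mul (by positivity) (by positivity),
      Real.log_pow, Real.log_pow, Real.log_pow]
    simp only [Nat.cast_ofNat, L]
  have hn' : (n : ℝ) = 2 * h - 1 := by
    have : (n : ℝ) + 1 = 2 * h := by exact_mod_cast hn
    linarith
  have hk' : (k : ℝ) ≤ n := by exact_mod_cast hk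
  have hk0 : (0 : ℝ) ≤ k := Nat.cast_nonneg k
  have hh1 : (1 : ℝ) ≤ h := by
    have : 1 ≤ h := by omega
    exact_mod_cast this
  push_cast [Nat.cast_sub hk] at e2 e4
  rw [abs_le] at e1 e2 e3 e4
  rw [hlog, eq_sub_of_add_eq he]
  have hexp : ((h : ℝ) ^ 2 - k * (n - k + 1)) + (((n : ℝ) + k) * (n + k + 1) / 2
      + (n : ℝ) * (n + 1) / 2) - (3 * ((k : ℝ) * (k + 1) / 2)
      + 2 * (((n : ℝ) - k) * (n - k + 1) / 2)) ≤ 5 * (h : ℝ) ^ 2 := by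
    have : ((h : ℝ) ^ 2 - k * (n - k + 1)) + (((n : ℝ) + k) * (n + k + 1) / 2
      + (n : ℝ) * (n + 1) / 2) - (3 * ((k : ℝ) * (k + 1) / 2)
      + 2 * (((n : ℝ) - k) * (n - k + 1) / 2)) = (h : ℝ) ^ 2 + n ^ 2 - (n - k) ^ 2 - k := by ring
    rw [this, hn']
    nlinarith [sq_nonneg ((n : ℝ) - k)]
  have := mul_le_mul_of_nonneg_right hexp hL.le
  linarith [e1.1, e1.2, e2.1, e2.2, e3.1, e3.2, e4.1, e4.2]

lemma abs_formCoeff_le (hp : 2 ≤ |p|) (hn : n + 1 = 2 * h) :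
    |formCoeff p n h| ≤ Real.exp (5 * Real.log (|(p : ℝ)|) * (h : ℝ) ^ 2 + 28 + 2 * h) := by
  rw [formCoeff]
  refine (Finset.abs_sum_le_sum_abs _ _).trans ?_
  refine (Finset.sum_le_sum fun k hk => abs_leadCoeff_le hp hn
    (Nat.lt_succ_iff.1 (Finset.mem_range.1 hk))).trans ?_
  rw [Finset.sum_const, Finset.card_range, Nat.succ_eq_add_one, hn, nsmul_eq_mul, Real.exp_add _ (2 * (h : ℝ)), mul_comm]
  gcongr
  push_cast
  linarith [Real.add_one_le_exp (2 * (h : ℝ))]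

end Sizes

lemma eventually_linear_le_sq (a b : ℝ) {δ : ℝ} (hδ : 0 < δ) :
    ∀ᶠ h : ℕ in atTop, a * h + b ≤ δ * (h : ℝ) ^ 2 := by
  filter_upwards [tendsto_natCast_atTop_atTop.eventually_ge_atTop ((|a| + |b|) / δ),
    eventually_ge_atTop 1] with h h1 h2
  have h2' : (1 : ℝ) ≤ h := by exact_mod_cast h2
  rw [div_le_iff₀ hδ] at h1
  have ha : a * h ≤ |a| * h := by gcongr; exact le_abs_self a
  have hb : b ≤ |b| * h := (le_abs_self b).trans (le_mul_of_one_le_right (abs_nonneg b) h2')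
  nlinarith

/-- `log |∏_{d ≤ 2h-1} Φ_d(p)|` is asymptotic to `(12 / π²) log |p| h²`. -/
lemma tendsto_log_cycProd_odd {p : ℤ} (hp : 2 ≤ |p|) :
    Tendsto (fun h : ℕ => Real.log |(cycProd p (2 * h - 1) : ℝ)| / (h : ℝ) ^ 2) atTop
      (𝓝 (12 / Real.pi ^ 2 * Real.log (|(p : ℝ)|))) := by
  have hsub : Tendsto (fun h : ℕ => 2 * h - 1) atTop atTop :=
    tendsto_atTop_mono (fun h => by omega : ∀ h : ℕ, h - 1 ≤ 2 * h - 1) (tendsto_sub_atTop_nat 1)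
  have h1 := (tendsto_log_cycProd_div_sq hp).comp hsub
  have h2 : Tendsto (fun h : ℕ => (2 - 1 / (h : ℝ)) ^ 2) atTop (𝓝 ((2 - 0) ^ 2)) :=
    ((tendsto_const_nhds (x := (2 : ℝ))).sub (tendsto_one_div_atTop_nhds_zero_nat (𝕜 := ℝ))).pow 2
  have h3 := h1.mul h2
  have e : 3 / Real.pi ^ 2 * Real.log (|(p : ℝ)|) * (2 - 0) ^ 2
      = 12 / Real.pi ^ 2 * Real.log (|(p : ℝ)|) := by ring
  rw [e] at h3
  refine h3.congr' ?_
  filter_upwards [eventually_ge_atTop 1] with h hh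
  have hh' : (1 : ℝ) ≤ h := by exact_mod_cast hh
  simp only [Function.comp]
  rw [Nat.cast_sub (by omega)]
  push_cast
  have h4 : (2 : ℝ) * h - 1 ≠ 0 := by linarith
  field_simp

/-- Integer linear forms in `1` and `ζ_q(2)` with their sizes. -/
lemma exists_linearForms {p : ℤ} (hp : 2 ≤ |p|) :
    ∃ A B : ℕ → ℤ,
      (∀ δ > 0, ∀ᶠ h : ℕ in atTop,
        Real.exp (-(((5 - 24 / Real.pi ^ 2) * Real.log (|(p : ℝ)|) + δ) * (h : ℝ) ^ 2))
          ≤ |(A h : ℝ) * qZeta (1 / (p : ℝ)) 2 - B h|) ∧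
      (∀ δ > 0, ∀ᶠ h : ℕ in atTop, |(A h : ℝ) * qZeta (1 / (p : ℝ)) 2 - B h|
        ≤ Real.exp (-(((5 - 24 / Real.pi ^ 2) * Real.log (|(p : ℝ)|) - δ) * (h : ℝ) ^ 2))) ∧
      (∀ δ > 0, ∀ᶠ h : ℕ in atTop, |(A h : ℝ)|
        ≤ Real.exp (((5 + 24 / Real.pi ^ 2) * Real.log (|(p : ℝ)|) + δ) * (h : ℝ) ^ 2)) := by
  set L := Real.log (|(p : ℝ)|)
  have hAex : ∀ h : ℕ, ∃ z : ℤ, (z : ℝ)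
      = (cycProd p (2 * h - 1) : ℝ) ^ 2 * formCoeff p (2 * h - 1) h := fun h =>
    mul_mem (pow_mem (intCast_mem_realInts _) 2) (formCoeff_mem_realInts hp)
  have hBex : ∀ h : ℕ, ∃ z : ℤ, (z : ℝ)
      = (cycProd p (2 * h - 1) : ℝ) ^ 2 * formConst p (2 * h - 1) h := fun h =>
    cycProd_sq_mul_formConst_mem_realInts hp
  choose A hA using hAex
  choose B hB using hBex
  have hD : ∀ h, 0 < |(cycProd p (2 * h - 1) : ℝ)| := fun h =>
    abs_pos.2 (by exact_mod_cast cycProd_ne_zero hp _)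
  have hDlog : ∀ δ > 0, ∀ᶠ h : ℕ in atTop,
      |Real.log |(cycProd p (2 * h - 1) : ℝ)| - 12 / Real.pi ^ 2 * L * (h : ℝ) ^ 2|
        ≤ δ * (h : ℝ) ^ 2 := by
    intro δ hδ
    filter_upwards [(Metric.tendsto_nhds.1 (tendsto_log_cycProd_odd hp)) δ hδ,
      eventually_ge_atTop 1] with h h1 h2
    have h2' : (0 : ℝ) < (h : ℝ) ^ 2 := by
      have : (0 : ℝ) < h := by exact_mod_cast h2
      positivity
    rw [Real.dist_eq] at h1
    have : Real.log |(cycProd p (2 * h - 1) : ℝ)| - 12 / Real.pi ^ 2 * L * (h : ℝ) ^ 2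
        = (Real.log |(cycProd p (2 * h - 1) : ℝ)| / (h : ℝ) ^ 2 - 12 / Real.pi ^ 2 * L)
          * (h : ℝ) ^ 2 := by
      field_simp
    rw [this, abs_mul, abs_of_pos h2']
    exact mul_le_mul_of_nonneg_right h1.le h2'.le
  have hform : ∀ h : ℕ, 4 ≤ h → ∃ R : ℝ,
      |Real.log R - (-5 * (h : ℝ) ^ 2 + 3 * h) * L| ≤ 24 ∧ 0 < R ∧
      2 / 3 * (|(cycProd p (2 * h - 1) : ℝ)| ^ 2 * R)
        ≤ |(A h : ℝ) * qZeta (1 / (p : ℝ)) 2 - B h| ∧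
      |(A h : ℝ) * qZeta (1 / (p : ℝ)) 2 - B h|
        ≤ 4 / 3 * (|(cycProd p (2 * h - 1) : ℝ)| ^ 2 * R) := by
    intro h hh
    have hn : 2 * h - 1 + 1 = 2 * h := by omega
    have h1 := abs_linearForm_sub_le hp hn (by omega)
    refine ⟨_, abs_log_summand_first_sub hp hn, abs_pos.2 (summand_first_ne_zero hp _ _), ?_⟩
    set R := summand p (2 * h - 1) h ((p : ℝ) ^ (2 * h - 1 + 1))
    set I := formCoeff p (2 * h - 1) h * qZeta (1 / (p : ℝ)) 2 - formConst p (2 * h - 1) h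
    have hI : (A h : ℝ) * qZeta (1 / (p : ℝ)) 2 - B h = (cycProd p (2 * h - 1) : ℝ) ^ 2 * I := by
      rw [hA, hB]; ring
    rw [hI, abs_mul, abs_pow]
    have h2 := abs_sub_abs_le_abs_sub I R
    have h3 := abs_sub_abs_le_abs_sub R I
    rw [abs_sub_comm R I] at h3
    have h4 := pow_pos (hD h) 2
    constructor
    · rw [mul_left_comm]
      exact mul_le_mul_of_nonneg_left (by linarith) h4.le
    · rw [mul_left_comm]
      exact mul_le_mul_of_nonneg_left (by linarith) h4.le
  have hsq : ∀ x : ℝ, 0 < x → x ^ 2 = Real.exp (2 * Real.log x) := fun x hx => by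
    rw [two_mul, Real.exp_add, Real.exp_log hx, sq]
  have hlogform : ∀ c : ℝ, 0 < c → ∀ h : ℕ, ∀ R : ℝ, 0 < R →
      c * (|(cycProd p (2 * h - 1) : ℝ)| ^ 2 * R)
        = Real.exp (Real.log c + 2 * Real.log |(cycProd p (2 * h - 1) : ℝ)| + Real.log R) := by
    intro c hc h R hR
    rw [Real.exp_add, Real.exp_add, Real.exp_log hc, Real.exp_log hR, ← hsq _ (hD h)]
    ring
  refine ⟨A, B, fun δ hδ => ?_, fun δ hδ => ?_, fun δ hδ => ?_⟩
  · filter_upwards [hDlog (δ / 4) (by positivity), eventually_ge_atTop 4,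
      eventually_linear_le_sq (-3 * L) (24 - Real.log (2 / 3)) (half_pos hδ)] with h k1 k2 k3
    obtain ⟨R, r1, r2, r3, -⟩ := hform h k2
    refine le_trans ?_ r3
    rw [hlogform _ (by norm_num) h R r2, Real.exp_le_exp]
    rw [abs_le] at k1 r1
    have e : ((5 - 24 / Real.pi ^ 2) * L + δ) * (h : ℝ) ^ 2 = 5 * L * (h : ℝ) ^ 2
      - 2 * (12 / Real.pi ^ 2 * L * (h : ℝ) ^ 2) + δ * (h : ℝ) ^ 2 := by ring
    rw [e]
    linarith [k1.1, r1.1]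
  · filter_upwards [hDlog (δ / 4) (by positivity), eventually_ge_atTop 4,
      eventually_linear_le_sq (3 * L) (24 + Real.log (4 / 3)) (half_pos hδ)] with h k1 k2 k3
    obtain ⟨R, r1, r2, -, r3⟩ := hform h k2
    refine r3.trans ?_
    rw [hlogform _ (by norm_num) h R r2, Real.exp_le_exp]
    rw [abs_le] at k1 r1
    have e : ((5 - 24 / Real.pi ^ 2) * L - δ) * (h : ℝ) ^ 2 = 5 * L * (h : ℝ) ^ 2
      - 2 * (12 / Real.pi ^ 2 * L * (h : ℝ) ^ 2) - δ * (h : ℝ) ^ 2 := by ring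
    rw [e]
    linarith [k1.2, r1.2]
  · filter_upwards [hDlog (δ / 4) (by positivity), eventually_ge_atTop 4,
      eventually_linear_le_sq 2 28 (half_pos hδ)] with h k1 k2 k3
    have h1 := abs_formCoeff_le hp (n := 2 * h - 1) (h := h) (by omega)
    rw [hA, abs_mul, abs_pow]
    calc |(cycProd p (2 * h - 1) : ℝ)| ^ 2 * |formCoeff p (2 * h - 1) h|
        ≤ |(cycProd p (2 * h - 1) : ℝ)| ^ 2 * Real.exp (5 * L * (h : ℝ) ^ 2 + 28 + 2 * h) := by
          gcongr
      _ = Real.exp (2 * Real.log |(cycProd p (2 * h - 1) : ℝ)|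
            + (5 * L * (h : ℝ) ^ 2 + 28 + 2 * h)) := by
          rw [Real.exp_add (2 * Real.log _), ← hsq _ (hD h)]
      _ ≤ _ := by
          rw [Real.exp_le_exp]
          rw [abs_le] at k1
          have e : ((5 + 24 / Real.pi ^ 2) * L + δ) * (h : ℝ) ^ 2 = 5 * L * (h : ℝ) ^ 2
            + 2 * (12 / Real.pi ^ 2 * L * (h : ℝ) ^ 2) + δ * (h : ℝ) ^ 2 := by ring
          rw [e]
          linarith [k1.2]

lemma irrational_of_size_linearForms {α τ : ℝ} {A B : ℕ → ℤ} (hτ : 0 < τ)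
    (hlow : ∀ δ > 0, ∀ᶠ h : ℕ in atTop,
      Real.exp (-((τ + δ) * (h : ℝ) ^ 2)) ≤ |(A h : ℝ) * α - B h|)
    (hup : ∀ δ > 0, ∀ᶠ h : ℕ in atTop,
      |(A h : ℝ) * α - B h| ≤ Real.exp (-((τ - δ) * (h : ℝ) ^ 2))) : Irrational α := by
  refine irrational_of_linearForms (A := A) (B := B) ?_ ?_
  · filter_upwards [hlow 1 one_pos] with h hh
    exact abs_pos.1 ((Real.exp_pos _).trans_le hh)
  · have h1 : Tendsto (fun h : ℕ => (τ - τ / 2) * (h : ℝ) ^ 2) atTop atTop :=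
      ((tendsto_pow_atTop two_ne_zero).comp tendsto_natCast_atTop_atTop).const_mul_atTop
        (by linarith)
    refine squeeze_zero_norm' ?_ (Real.tendsto_exp_neg_atTop_nhds_zero.comp h1)
    filter_upwards [hup (τ / 2) (by linarith)] with h hh
    simpa [Real.norm_eq_abs] using hh

theorem theorem2 :
    ∃ c : ℝ, 4.07869374 ≤ c ∧ c < 4.07869375 ∧
      ∀ p : ℤ, p ≠ 0 → p ≠ 1 → p ≠ -1 →
        ∀ q : ℝ, q = 1 / (p : ℝ) →
          Irrational (qZeta q 2) ∧
            ∃ μ : ℝ, IsIrrationalityExponent (qZeta q 2) μ ∧ μ ≤ c := by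
  refine ⟨4.07869374, le_rfl, by norm_num, ?_⟩
  rintro p h0 h1 h2 q rfl
  have hp : 2 ≤ |p| := by
    rcases abs_cases p with ⟨h, _⟩ | ⟨h, _⟩ <;> omega
  have hL := log_abs_cast_nonneg hp
  have hpi : (9.85 : ℝ) < Real.pi ^ 2 := by nlinarith [Real.pi_gt_d2]
  have hfrac : 24 / Real.pi ^ 2 < 2.44 := by
    rw [div_lt_iff₀ (by linarith)]; linarith
  have hfrac0 : 0 < 24 / Real.pi ^ 2 := by positivity
  obtain ⟨A, B, hlow, hup, hA⟩ := exists_linearForms hp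
  set x := 24 / Real.pi ^ 2
  set L := Real.log (|(p : ℝ)|)
  have hτ : 0 < (5 - x) * L := mul_pos (by linarith) hL
  have hσ : 0 ≤ (5 + x) * L := (mul_pos (by linarith) hL).le
  refine ⟨irrational_of_size_linearForms hτ hlow hup, ?_⟩
  obtain ⟨μ, hμ, hle⟩ := exists_irrationalityExponent_le
    (finite_approx_of_linearForms hτ hσ hlow hup hA)
  refine ⟨μ, hμ, hle.trans ?_⟩
  rw [mul_div_mul_right _ _ hL.ne']
  have : (5 + x) / (5 - x) ≤ 3.07869374 := by
    rw [div_le_iff₀ (by linarith)]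
    linarith
  linarith
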